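/- Let $n \ge 0$ be an integer, let $\widetilde M = \mathbb{Z}\langle e_1,\dots,e_{n+2}\rangle$, $M = \widetilde M/\langle e_1+\dots+e_{n+2}\rangle$, $\widetilde M_{\mathbb C}=\widetilde M\otimes\mathbb C$, and $\mathbb{T} = \mathrm{Hom}(M,\mathbb{C}^*)$. Let $A = \Lambda^*(\widetilde M_{\mathbb{C}})$ be the exterior algebra, with the $\mathbb{Q}$-grading equal to $n/(n+2)$ times the usual grading (signs are determined by the usual grading mod $2$), and with $\mathbb{T}$ acting by algebra automorphisms such that $\alpha\cdot e_i = \alpha(e_i)e_i$. For an integer $s \ge 0$ and $t\in\mathbb{Q}$ let $HH^{s+t}(A,A)^{t,\mathbb{T}}$ be the cohomology, at the $\mathbb{T}$-equivariant multilinear maps $f : A^{\otimes s}\to A$ of degree $t$, of the Hochschild differential $$(\delta f)(a_0,\dots,a_s) = (-1)^{|f||a_0|}a_0 f(a_1,\dots,a_s)+\sum_{i=0}^{s-1}(-1)^{i+1}f(a_0,\dots,a_ia_{i+1},\dots,a_s)+(-1)^{s+1}f(a_0,\dots,a_{s-1})a_s .$$ Write $\mathrm{Sym}^*(\widetilde M_{\mathbb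 C}^\vee)=\mathbb{C}[z_1,\dots,z_{n+2}]$, where $z_1,\dots,z_{n+2}$ is the basis dual to $e_1,\dots,e_{n+2}$. Then the Hochschild-Kostant-Rosenberg map $f\mapsto f(z,\dots,z)$, $z=\sum_j z_je_j$ (that is, $f \mapsto \sum_{i_1,\dots,i_s} z_{i_1}\cdots z_{i_s}\otimes f(e_{i_1},\dots,e_{i_s})$), induces for all $s$ and $t$ a linear isomorphism $$HH^{s+t}(A,A)^{t,\mathbb{T}} \cong \bigoplus_{j\,:\,\frac{2}{n+2}s+\frac{n}{n+2}j=s+t}\left(\mathrm{Sym}^s(\widetilde M_{\mathbb{C}}^\vee)\otimes\Lambda^j(\widetilde M_{\mathbb{C}})\right)^{\mathbb{T}}.$$ For every integer $d>2$, this isomorphism identifies $HH^2(A,A)^{2-d,\mathbb{T}}$ (that is, $s=d$ and $t=2-d$) with the line $\mathbb{C}\cdot W$, $W=z_1z_2\cdots z_{n+2}\in \mathrm{Sym}^{n+2}(\widetilde M_{\mathbb{C}}^\vee)$, if $d=n+2$; and $HH^2(A,A)^{2-d,\mathbb{T}}=0$ if $d\neq n+2$. -/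

import Mathlib

open scoped TensorProduct

noncomputable section

namespace EquivHH

/-! ### The exterior algebra, its grading and the torus action -/

/-- The complexified lattice `M̃ ⊗ ℂ = ℂ^{n+2}`. -/
abbrev V (n : ℕ) : Type := Fin (n + 2) → ℂ

/-- The exterior algebra `A = Λ^*(ℂ^{n+2})`. -/
abbrev A (n : ℕ) : Type := ExteriorAlgebra ℂ (V n)

/-- The generator `e_i` of `A`. -/
def gen (n : ℕ) (i : Fin (n + 2)) : A n := ExteriorAlgebra.ι ℂ (Pi.single i (1 : ℂ))

/-- The lattice `M = ℤ⟨e_1, …, e_{n+2}⟩ / ⟨e_1 + ⋯ + e_{n+2}⟩`. -/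
abbrev M (n : ℕ) : Type :=
  (Fin (n + 2) → ℤ) ⧸ AddSubgroup.zmultiples (fun _ : Fin (n + 2) => (1 : ℤ))

/-- The class of `e_i` in `M`. -/
def eM (n : ℕ) (i : Fin (n + 2)) : M n := QuotientAddGroup.mk (Pi.single i (1 : ℤ))

/-- The torus `𝕋 = Hom(M, ℂ^*)`. -/
abbrev Torus (n : ℕ) : Type := AddChar (M n) ℂˣ

/-- The action of `α ∈ 𝕋` on `A` by algebra homomorphisms, with `α · e_i = α(e_i) e_i`. -/
def torusAct {n : ℕ} (α : Torus n) : A n →ₐ[ℂ] A n :=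
  ExteriorAlgebra.map
    (LinearMap.pi fun i => ((α (eM n i) : ℂˣ) : ℂ) • (LinearMap.proj i : V n →ₗ[ℂ] ℂ))

/-- The part of `A` of degree `q ∈ ℚ`: the `ℚ`-grading is `n / (n + 2)` times the usual grading. -/
def gradedPart (n : ℕ) (q : ℚ) : Submodule ℂ (A n) :=
  ⨆ (k : ℕ) (_ : (n : ℚ) / (n + 2) * k = q), ⋀[ℂ]^k (V n)

/-- The parity involution of `A`, acting by `(-1)^k` on `Λ^k`. -/
def parity (n : ℕ) : A n →ₐ[ℂ] A n := ExteriorAlgebra.map (-LinearMap.id)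

/-- The projection of `A` to its even part `⨁ Λ^{2k}`. -/
def evenPart (n : ℕ) : A n →ₗ[ℂ] A n :=
  (1 / 2 : ℂ) • (LinearMap.id + (parity n).toLinearMap)

/-- The projection of `A` to its odd part `⨁ Λ^{2k+1}`. -/
def oddPart (n : ℕ) : A n →ₗ[ℂ] A n :=
  (1 / 2 : ℂ) • (LinearMap.id - (parity n).toLinearMap)

/-! ### The Hochschild complex of the graded algebra `A` -/

/-- All multilinear maps `A^s → A`, that is `Hom(A^{⊗ s}, A)`. -/
abbrev Cochain (n s : ℕ) : Type := MultilinearMap ℂ (fun _ : Fin s => A n) (A n)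

instance (n s : ℕ) : AddCommGroup (Cochain n s) := MultilinearMap.instAddCommGroup

/-- `f ↦ (-1)^{|f|} f`, where `|f| ∈ ℤ/2` is the parity of `f` as a map of super vector spaces. -/
def conjParity {n s : ℕ} (f : Cochain n s) : Cochain n s :=
  (parity n).toLinearMap.compMultilinearMap
    (f.compLinearMap fun _ => (parity n).toLinearMap)

/-- The term `(-1)^{|f| |a_0|} a_0 f(a_1, …, a_s)`; for even `a_0` there is no sign, for odd `a_0`
the sign is `(-1)^{|f|}`. -/
def leftTerm {n s : ℕ} (f : Cochain n s) : Cochain n (s + 1) :=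
  LinearMap.uncurryLeft
    { toFun := fun a =>
        (LinearMap.mulLeft ℂ (evenPart n a)).compMultilinearMap f +
          (LinearMap.mulLeft ℂ (oddPart n a)).compMultilinearMap (conjParity f)
      map_add' := by
        intro a b
        ext m
        simp [add_mul]
        abel
      map_smul' := by
        intro c a
        ext m
        simp }

/-- The term `f(a_0, …, a_{s-1}) a_s`. -/
def rightTerm {n s : ℕ} (f : Cochain n s) : Cochain n (s + 1) :=
  MultilinearMap.uncurryRight ((LinearMap.mul ℂ (A n)).compMultilinearMap f)

/-- Multiplying the entries `i` and `i + 1` of a tuple: updating one entry of the long tuple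
updates one entry of the short one. -/
theorem contract_update {R : Type*} [Mul R] {s : ℕ} (i : Fin s) (m : Fin (s + 1) → R)
    (j : Fin (s + 1)) :
    ∃ (k : Fin s) (g : R → R), (g = id ∨ (∃ b, g = fun x => x * b) ∨ (∃ b, g = fun x => b * x)) ∧
      ∀ x, Fin.contractNth i.castSucc (· * ·) (Function.update m j x) =
        Function.update (Fin.contractNth i.castSucc (· * ·) m) k (g x) := by
  rcases lt_trichotomy j.val i.val with h | h | h
  · refine ⟨⟨j.val, by omega⟩, id, Or.inl rfl, fun x => ?_⟩
    ext k
    simp only [Fin.contractNth, Function.update_apply, Fin.ext_iff, Fin.val_castSucc,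
      Fin.val_succ, id]
    grind
  · refine ⟨i, fun x => x * m i.succ, Or.inr (Or.inl ⟨_, rfl⟩), fun x => ?_⟩
    ext k
    simp only [Fin.contractNth, Function.update_apply, Fin.ext_iff, Fin.val_castSucc,
      Fin.val_succ]
    grind
  · by_cases h' : j.val = i.val + 1
    · refine ⟨i, fun x => m i.castSucc * x, Or.inr (Or.inr ⟨_, rfl⟩), fun x => ?_⟩
      ext k
      simp only [Fin.contractNth, Function.update_apply, Fin.ext_iff, Fin.val_castSucc,
        Fin.val_succ]
      grind
    · refine ⟨⟨j.val - 1, by omega⟩, id, Or.inl rfl, fun x => ?_⟩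
      ext k
      simp only [Fin.contractNth, Function.update_apply, Fin.ext_iff, Fin.val_castSucc,
        Fin.val_succ, id]
      grind

/-- The term `f(a_0, …, a_i a_{i+1}, …, a_s)`. -/
def innerTerm {n s : ℕ} (i : Fin s) (f : Cochain n s) : Cochain n (s + 1) where
  toFun a := f (Fin.contractNth i.castSucc (· * ·) a)
  map_update_add' := by
    intro inst m j x y
    obtain rfl : inst = instDecidableEqFin (s + 1) := Subsingleton.elim _ _
    obtain ⟨k, g, hg, h⟩ := contract_update i m j
    rcases hg with rfl | ⟨b, rfl⟩ | ⟨b, rfl⟩ <;> simp [h, add_mul, mul_add]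
  map_update_smul' := by
    intro inst m j c x
    obtain rfl : inst = instDecidableEqFin (s + 1) := Subsingleton.elim _ _
    obtain ⟨k, g, hg, h⟩ := contract_update i m j
    rcases hg with rfl | ⟨b, rfl⟩ | ⟨b, rfl⟩ <;> simp [h]

/-- The Hochschild differential
`(δ f)(a_0, …, a_s) = (-1)^{|f| |a_0|} a_0 f(a_1, …, a_s)
  + ∑_{i < s} (-1)^{i+1} f(a_0, …, a_i a_{i+1}, …, a_s) + (-1)^{s+1} f(a_0, …, a_{s-1}) a_s`. -/
def hochDiff (n s : ℕ) : Cochain n s →ₗ[ℂ] Cochain n (s + 1) where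
  toFun f :=
    leftTerm f + ∑ i : Fin s, (-1 : ℂ) ^ (i.val + 1) • innerTerm i f +
      (-1 : ℂ) ^ (s + 1) • rightTerm f
  map_add' f g := by
    ext m
    simp [leftTerm, rightTerm, innerTerm, conjParity, mul_add, Finset.sum_add_distrib]
    abel
  map_smul' c f := by
    ext m
    simp [leftTerm, rightTerm, innerTerm, conjParity, Finset.smul_sum, smul_comm c]

/-- `CC^{s+t}(A,A)^{t,𝕋}`: the `𝕋`-equivariant maps `A^{⊗ s} → A` of degree `t ∈ ℚ`. -/
def cochains (n s : ℕ) (t : ℚ) : Submodule ℂ (Cochain n s) where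
  carrier := {f |
    (∀ (q : Fin s → ℚ) (a : Fin s → A n), (∀ i, a i ∈ gradedPart n (q i)) →
      f a ∈ gradedPart n (t + ∑ i, q i)) ∧
    ∀ (α : Torus n) (a : Fin s → A n), f (fun i => torusAct α (a i)) = torusAct α (f a)}
  add_mem' {f g} hf hg := by
    refine ⟨fun q a ha => ?_, fun α a => ?_⟩
    · exact add_mem (hf.1 q a ha) (hg.1 q a ha)
    · simp [hf.2 α a, hg.2 α a]
  zero_mem' := by
    refine ⟨fun q a ha => ?_, fun α a => ?_⟩ <;> simp
  smul_mem' c f hf := by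
    refine ⟨fun q a ha => ?_, fun α a => ?_⟩
    · exact Submodule.smul_mem _ c (hf.1 q a ha)
    · simp [hf.2 α a]

/-- Equivariant Hochschild cocycles of bidegree `(s, t)`. -/
def cocycles (n s : ℕ) (t : ℚ) : Submodule ℂ (Cochain n s) :=
  cochains n s t ⊓ LinearMap.ker (hochDiff n s)

/-- Equivariant Hochschild coboundaries of bidegree `(s, t)`. -/
def coboundaries (n : ℕ) : (s : ℕ) → (t : ℚ) → Submodule ℂ (Cochain n s)
  | 0, _ => ⊥
  | s + 1, t => (cochains n s t).map (hochDiff n s)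

/-- The equivariant Hochschild cohomology `HH^{s+t}(A,A)^{t,𝕋}`, with `s` the number of inputs and
`t` the degree in `ℚ`. So `HH^2(A,A)^{2-d,𝕋}` is `HH n d (2 - d)`. -/
abbrev HH (n s : ℕ) (t : ℚ) : Type :=
  cocycles n s t ⧸ (coboundaries n s t).submoduleOf (cocycles n s t)

/-! ### The Hochschild-Kostant-Rosenberg map -/

/-- `Sym(M̃_ℂ^∨) ⊗ Λ(M̃_ℂ)`, where `Sym(M̃_ℂ^∨) = ℂ[z_1, …, z_{n+2}]`, `z_i` dual to `e_i`. -/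
abbrev PolyVec (n : ℕ) : Type := MvPolynomial (Fin (n + 2)) ℂ ⊗[ℂ] A n

/-- The action of `α ∈ 𝕋` on `Sym(M̃_ℂ^∨) ⊗ Λ(M̃_ℂ)`, with `α · z_i = α(e_i)⁻¹ z_i` and
`α · e_i = α(e_i) e_i`. -/
def polyVecAct {n : ℕ} (α : Torus n) : PolyVec n →ₗ[ℂ] PolyVec n :=
  TensorProduct.map
    (MvPolynomial.aeval fun i =>
      MvPolynomial.C (((α (eM n i))⁻¹ : ℂˣ) : ℂ) * MvPolynomial.X i).toLinearMap
    (torusAct α).toLinearMap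

/-- The `𝕋`-invariant part of `Sym(M̃_ℂ^∨) ⊗ Λ(M̃_ℂ)`. -/
def invariants (n : ℕ) : Submodule ℂ (PolyVec n) :=
  ⨅ α : Torus n, LinearMap.eqLocus (polyVecAct α) LinearMap.id

/-- `Sym^s(M̃_ℂ^∨) ⊗ Λ^j(M̃_ℂ)`. -/
def symExt (n s j : ℕ) : Submodule ℂ (PolyVec n) :=
  LinearMap.range (TensorProduct.map
    (MvPolynomial.homogeneousSubmodule (Fin (n + 2)) ℂ s).subtype (⋀[ℂ]^j (V n)).subtype)

/-- The sum of `(Sym^s(M̃_ℂ^∨) ⊗ Λ^j(M̃_ℂ))^𝕋` over all `j` with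
`(2 / (n + 2)) s + (n / (n + 2)) j = s + t`. -/
def hkrTarget (n s : ℕ) (t : ℚ) : Submodule ℂ (PolyVec n) :=
  ⨆ (j : ℕ) (_ : (2 : ℚ) / (n + 2) * s + (n : ℚ) / (n + 2) * j = s + t),
    symExt n s j ⊓ invariants n

/-- The Hochschild-Kostant-Rosenberg map `f ↦ f(z, …, z)`, where `z = ∑ z_j e_j`. -/
def hkr {n s : ℕ} (f : Cochain n s) : PolyVec n :=
  ∑ I : Fin s → Fin (n + 2), (∏ k, MvPolynomial.X (I k)) ⊗ₜ[ℂ] f (fun k => gen n (I k))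

/-- The superpotential `W = z_1 ⋯ z_{n+2}`, as the element `W ⊗ 1` of
`Sym^{n+2}(M̃_ℂ^∨) ⊗ Λ^0(M̃_ℂ)`. -/
def superW (n : ℕ) : PolyVec n := (∏ i : Fin (n + 2), MvPolynomial.X i) ⊗ₜ[ℂ] (1 : A n)

end EquivHH

end

/-!
The Hochschild-Kostant-Rosenberg isomorphism for the exterior algebra `A` holds because `A` is a
Koszul algebra. The proof makes the Koszul property explicit by a matching, in the sense of discrete
Morse theory, on the words `e_{w_0} ⊗ ⋯ ⊗ e_{w_{s-1}}` in the monomial basis of `A`.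

A word is *critical* if it is a weakly decreasing sequence of generators. A word without empty
letters is *upper* if it begins with a weakly decreasing sequence of generators `i_0 ≥ ⋯ ≥ i_k`
followed by a monomial `J` with `i_k < J`, and it is then matched with the *lower* word in which
`i_k` and `J` are replaced by their product. A word with an empty letter (that is, a factor `1`) is
upper or lower according to the parity of the length of its first run of empty letters. Every word
is upper, lower or critical (`isUpper_or_isCritical_or_exists`), and the matching is a bijection
from upper words of length `s + 1` to lower words of length `s` (`eq_of_merge_eq`,
`not_isUpper_merge`, `not_isCritical_merge`).

If `u` is matched with `w`, then `(δ f)(u)` is a nonzero multiple of `f(w)` plus values of `f` on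
upper words and on words with fewer generators or fewer inversions. Hence a cochain that vanishes on
upper and critical words, and whose differential vanishes on upper words, is zero
(`eq_zero_of_forall_isUpper`). Counting dimensions in the space of equivariant cochains of degree
`t`, the values of `f` on upper and critical words and those of `δ f` on upper words can be
prescribed arbitrarily (`exists_cochain_of_isUpper`).

The map `f ↦ f(z, …, z)` kills coboundaries, since the `z_i` commute while the generators of `A`
anticommute (`hkr_hochDiff`). On a cochain that vanishes on upper words it records exactly the
values on critical words, because a sequence of generators that is not weakly decreasing is an upper
word (`coeffAt_hkr_of_isUpper`). A cocycle in its kernel can be corrected by a coboundary so as to vanish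
on upper words, and then it is zero by uniqueness (`mem_coboundaries_of_hkr_eq_zero`). An element of
the target prescribes the critical values of a cochain `f` such that `f` and `δ f` vanish on upper
words, and then `δ f = 0`, again by uniqueness (`exists_cocycle_hkr_eq`).

Finally, a monomial `z^m ⊗ e_K` is invariant under the torus if and only if `1_K - m` is a constant
vector `(c, …, c)`. For `s = d > 2` and `t = 2 - d` the degree condition becomes `d + n c = 2`, which
forces `c = -1`, `K = ∅`, `m = (1, …, 1)` and `d = n + 2` (`eq_of_allowed`).
-/

noncomputable section

namespace EquivHH

/-! ### The monomial basis of the exterior algebra -/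

/-- The basis of `A` formed by the monomials `e_J = e_{j_1} ⋯ e_{j_k}`, one for each subset
`J = {j_1 < ⋯ < j_k}` of the index set. -/
def mono (n : ℕ) : Module.Basis (Finset (Fin (n + 2))) ℂ (A n) :=
  (Pi.basisFun ℂ (Fin (n + 2))).ExteriorAlgebra

theorem mono_eq_ιMulti {n k : ℕ} (J : Finset (Fin (n + 2))) (hJ : J.card = k) :
    mono n J = ExteriorAlgebra.ιMulti ℂ k
      (fun a => (Pi.single (J.orderEmbOfFin hJ a) (1 : ℂ) : V n)) := by
  rw [mono, ExteriorAlgebra.basis_apply_ofCard _ hJ]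
  simp only [ExteriorAlgebra.ιMulti_family]
  congr 1
  ext a : 1
  simp [Set.powersetCard.ofFinEmbEquiv_symm_apply, Pi.basisFun_apply]

theorem mono_empty (n : ℕ) : mono n ∅ = 1 := by
  rw [mono_eq_ιMulti (k := 0) ∅ rfl]
  simp

theorem mono_singleton {n : ℕ} (i : Fin (n + 2)) : mono n {i} = gen n i := by
  rw [mono_eq_ιMulti (k := 1) {i} rfl]
  simp [gen, ExteriorAlgebra.ιMulti_apply]

theorem mono_mul_of_not_disjoint {n : ℕ} {J K : Finset (Fin (n + 2))} (h : ¬Disjoint J K) :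
    mono n J * mono n K = 0 :=
  ExteriorAlgebra.basis_mul_of_not_disjoint (Pi.basisFun ℂ (Fin (n + 2)))
    (Set.powersetCard.ofCard (rfl : J.card = J.card))
    (Set.powersetCard.ofCard (rfl : K.card = K.card)) h

theorem exists_mono_mul_of_disjoint {n : ℕ} {J K : Finset (Fin (n + 2))} (h : Disjoint J K) :
    ∃ c : ℂ, c ≠ 0 ∧ mono n J * mono n K = c • mono n (J ∪ K) := by
  have := ExteriorAlgebra.basis_mul_of_disjoint (Pi.basisFun ℂ (Fin (n + 2)))
    (Set.powersetCard.ofCard (rfl : J.card = J.card))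
    (Set.powersetCard.ofCard (rfl : K.card = K.card)) h
  refine ⟨((Set.powersetCard.permOfDisjoint (s := Set.powersetCard.ofCard (rfl : J.card = J.card))
    (t := Set.powersetCard.ofCard (rfl : K.card = K.card)) h).sign : ℤ), by simp, ?_⟩
  rw [mono]
  refine this.trans ?_
  have e : ((Set.powersetCard.disjUnion (s := Set.powersetCard.ofCard (rfl : J.card = J.card))
    (t := Set.powersetCard.ofCard (rfl : K.card = K.card)) h) : Finset (Fin (n + 2))) = J ∪ K := by
    ext x
    simp [Set.powersetCard.disjUnion]
  rw [e, Units.smul_def, ← Int.cast_smul_eq_zsmul ℂ]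

/-- The algebra endomorphism of `A` which rescales the generators multiplies each monomial by the
product of the scalars of its letters. -/
theorem map_mono_of_diagonal {n : ℕ} (D : V n →ₗ[ℂ] V n) (c : Fin (n + 2) → ℂ)
    (hD : ∀ i, D (Pi.single i 1) = c i • Pi.single i 1) (J : Finset (Fin (n + 2))) :
    ExteriorAlgebra.map D (mono n J) = (∏ i ∈ J, c i) • mono n J := by
  rw [mono_eq_ιMulti (k := J.card) J rfl, ExteriorAlgebra.map_apply_ιMulti]
  have : (D ∘ fun a => (Pi.single (J.orderEmbOfFin rfl a) (1 : ℂ) : V n)) =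
      fun a => c (J.orderEmbOfFin rfl a) • (Pi.single (J.orderEmbOfFin rfl a) (1 : ℂ) : V n) := by
    ext1 a
    exact hD _
  rw [this, AlternatingMap.map_smul_univ]
  congr 1
  rw [← Finset.prod_coe_sort J]
  exact Fintype.prod_equiv (J.orderIsoOfFin rfl).toEquiv _ _ fun a => by simp

theorem torusAct_mono {n : ℕ} (α : Torus n) (J : Finset (Fin (n + 2))) :
    torusAct α (mono n J) = (∏ i ∈ J, ((α (eM n i) : ℂˣ) : ℂ)) • mono n J := by
  refine map_mono_of_diagonal _ _ (fun i => ?_) J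
  ext j
  by_cases h : j = i
  · subst h; simp
  · simp [h]

theorem parity_mono {n : ℕ} (J : Finset (Fin (n + 2))) :
    parity n (mono n J) = (-1 : ℂ) ^ J.card • mono n J := by
  have := map_mono_of_diagonal (n := n) (-LinearMap.id) (fun _ => -1) (fun i => by simp) J
  rwa [Finset.prod_const] at this

theorem exteriorPower_eq_span (n k : ℕ) :
    ⋀[ℂ]^k (V n) = Submodule.span ℂ (mono n '' {J | J.card = k}) := by
  rw [← exteriorPower.ιMulti_family_span_fixedDegree_of_span ℂ (v := Pi.basisFun ℂ (Fin (n + 2)))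
    (Pi.basisFun ℂ (Fin (n + 2))).span_eq]
  congr 1
  ext x
  constructor
  · rintro ⟨J, rfl⟩
    exact ⟨J.1, J.2, ExteriorAlgebra.basis_apply_powersetCard _ J⟩
  · rintro ⟨J, hJ, rfl⟩
    exact ⟨⟨J, hJ⟩, (ExteriorAlgebra.basis_apply_powersetCard _ _).symm⟩

theorem gradedPart_eq_span (n : ℕ) (q : ℚ) :
    gradedPart n q = Submodule.span ℂ (mono n '' {J | (n : ℚ) / (n + 2) * J.card = q}) := by
  simp only [gradedPart, exteriorPower_eq_span]
  apply le_antisymm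
  · refine iSup₂_le fun k hk => Submodule.span_mono (Set.image_mono ?_)
    rintro J rfl
    exact hk
  · rw [Submodule.span_le]
    rintro _ ⟨J, hJ, rfl⟩
    exact Submodule.mem_iSup_of_mem J.card (Submodule.mem_iSup_of_mem hJ
      (Submodule.subset_span ⟨J, rfl, rfl⟩))

theorem mono_mem_gradedPart {n : ℕ} (J : Finset (Fin (n + 2))) :
    mono n J ∈ gradedPart n ((n : ℚ) / (n + 2) * J.card) := by
  rw [gradedPart_eq_span]
  exact Submodule.subset_span ⟨J, rfl, rfl⟩

/-! ### Words in the monomials, and homogeneous cochains -/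

/-- A word of length `s` in the monomials of `A`, that is an element `e_{w_0} ⊗ ⋯ ⊗ e_{w_{s-1}}` of
the monomial basis of `A^{⊗ s}`. -/
abbrev Word (n s : ℕ) : Type := Fin s → Finset (Fin (n + 2))

/-- The tuple of monomials `(e_{w_0}, …, e_{w_{s-1}})` of a word. -/
def letters {n s : ℕ} (w : Word n s) : Fin s → A n := fun i => mono n (w i)

theorem cochain_ext {n s : ℕ} {f g : Cochain n s} (h : ∀ w, f (letters w) = g (letters w)) :
    f = g :=
  Module.Basis.ext_multilinear (fun _ => mono n) h

/-- Every function from words to `A` is the restriction of a cochain. -/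
theorem exists_cochain {n s : ℕ} (F : Word n s → A n) :
    ∃ f : Cochain n s, ∀ w, f (letters w) = F w := by
  refine ⟨∑ w : Word n s, (MultilinearMap.mkPiRing ℂ (Fin s) (F w)).compLinearMap
    fun i => (mono n).coord (w i), fun w => ?_⟩
  rw [sum_apply, Finset.sum_eq_single w]
  · simp [letters]
  · intro v _ hv
    obtain ⟨i, hi⟩ := Function.ne_iff.1 hv
    simp only [MultilinearMap.compLinearMap_apply, MultilinearMap.mkPiRing_apply]
    rw [Finset.prod_eq_zero (Finset.mem_univ i), zero_smul]
    simp [letters, Ne.symm hi]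
  · simp

/-- The multiplicity of each generator in a word. -/
def weight {n s : ℕ} (w : Word n s) : Fin (n + 2) → ℕ := fun i => ∑ j, if i ∈ w j then 1 else 0

/-- `e_K` may occur in the value of an equivariant cochain of degree `t` on an argument of weight
`m`: the degree of `e_K` is `t` more than that of the argument, and the torus acts by the same
character on both. -/
def Allowed {n : ℕ} (t : ℚ) (m : Fin (n + 2) → ℕ) (K : Finset (Fin (n + 2))) : Prop :=
  (n : ℚ) / (n + 2) * K.card = t + (n : ℚ) / (n + 2) * ((∑ i, m i : ℕ) : ℚ) ∧
    ∀ α : Torus n, ∏ i ∈ K, ((α (eM n i) : ℂˣ) : ℂ) = ∏ i, ((α (eM n i) : ℂˣ) : ℂ) ^ m i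

/-- The subspace of `A` in which an equivariant cochain of degree `t` takes its values on arguments
of weight `m`. -/
def valueSpace {n : ℕ} (t : ℚ) (m : Fin (n + 2) → ℕ) : Submodule ℂ (A n) :=
  Submodule.span ℂ (mono n '' {K | Allowed t m K})

theorem mem_valueSpace_iff {n : ℕ} {t : ℚ} {m : Fin (n + 2) → ℕ} {x : A n} :
    x ∈ valueSpace t m ↔ x ∈ gradedPart n (t + (n : ℚ) / (n + 2) * ((∑ i, m i : ℕ) : ℚ)) ∧
      ∀ α : Torus n, torusAct α x = (∏ i, ((α (eM n i) : ℂˣ) : ℂ) ^ m i) • x := by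
  constructor
  · intro hx
    constructor
    · rw [gradedPart_eq_span]
      exact Submodule.span_mono (Set.image_mono fun K hK => hK.1) hx
    · intro α
      refine Submodule.span_induction ?_ (by simp) (fun x y _ _ hx hy => by simp [hx, hy])
        (fun c x _ hx => by simp [hx, smul_comm c]) hx
      rintro _ ⟨K, hK, rfl⟩
      rw [torusAct_mono, hK.2 α]
  · rintro ⟨h1, h2⟩
    rw [gradedPart_eq_span, Module.Basis.mem_span_image] at h1
    rw [valueSpace, Module.Basis.mem_span_image]
    intro K hK
    refine ⟨h1 hK, fun α => ?_⟩
    have hT : ∀ y : A n, (mono n).repr (torusAct α y) K =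
        (∏ i ∈ K, ((α (eM n i) : ℂˣ) : ℂ)) * (mono n).repr y K := by
      intro y
      have : ((mono n).coord K).comp (torusAct α).toLinearMap =
          (∏ i ∈ K, ((α (eM n i) : ℂˣ) : ℂ)) • (mono n).coord K := by
        refine (mono n).ext fun J => ?_
        simp only [LinearMap.comp_apply, AlgHom.toLinearMap_apply, torusAct_mono,
          LinearMap.smul_apply, map_smul, Module.Basis.coord_apply, Module.Basis.repr_self,
          Finsupp.single_apply, smul_eq_mul]
        by_cases hJ : J = K
        · simp [hJ]
        · simp [hJ]
      exact LinearMap.congr_fun this y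
    have h3 := congrArg (fun y => (mono n).repr y K) (h2 α)
    simp only [hT, map_smul, Finsupp.smul_apply, smul_eq_mul] at h3
    exact mul_right_cancel₀ (Finsupp.mem_support_iff.1 hK) h3

theorem sum_card_eq_sum_weight {n s : ℕ} (w : Word n s) :
    ∑ j, (w j).card = ∑ i, weight w i := by
  simp only [weight]
  rw [Finset.sum_comm]
  simp

theorem prod_prod_eq_prod_pow_weight {n s : ℕ} (w : Word n s) (c : Fin (n + 2) → ℂ) :
    ∏ j, ∏ i ∈ w j, c i = ∏ i, c i ^ weight w i := by
  simp only [weight, ← Finset.prod_pow_eq_pow_sum]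
  rw [Finset.prod_comm]
  refine Finset.prod_congr rfl fun j _ => ?_
  simp [Finset.prod_ite_mem, pow_ite]

theorem mem_cochains_iff {n s : ℕ} {t : ℚ} {f : Cochain n s} :
    f ∈ cochains n s t ↔ ∀ w, f (letters w) ∈ valueSpace t (weight w) := by
  constructor
  · intro hf w
    rw [mem_valueSpace_iff]
    constructor
    · have := hf.1 (fun i => (n : ℚ) / (n + 2) * (w i).card) (letters w)
        fun i => mono_mem_gradedPart _
      rwa [← Finset.mul_sum, ← Nat.cast_sum, sum_card_eq_sum_weight] at this
    · intro α
      rw [← hf.2 α]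
      simp only [letters, torusAct_mono]
      rw [MultilinearMap.map_smul_univ, prod_prod_eq_prod_pow_weight]
      rfl
  · intro hf
    constructor
    · intro q a ha
      have ha' : ∀ i, a i = ∑ J, (mono n).repr (a i) J • mono n J :=
        fun i => ((mono n).sum_repr (a i)).symm
      rw [show a = fun i => ∑ J, (mono n).repr (a i) J • mono n J from funext ha',
        MultilinearMap.map_sum]
      refine Submodule.sum_mem _ fun w _ => ?_
      rw [MultilinearMap.map_smul_univ]
      by_cases h : ∏ i, (mono n).repr (a i) (w i) = 0
      · simp [h]
      · refine Submodule.smul_mem _ _ ?_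
        have hq : ∑ i, q i = (n : ℚ) / (n + 2) * ((∑ i, weight w i : ℕ) : ℚ) := by
          rw [← sum_card_eq_sum_weight, Nat.cast_sum, Finset.mul_sum]
          refine Finset.sum_congr rfl fun i _ => ?_
          have := ha i
          rw [gradedPart_eq_span, Module.Basis.mem_span_image] at this
          exact (this (Finsupp.mem_support_iff.2 (Finset.prod_ne_zero_iff.1 h i
            (Finset.mem_univ i)))).symm
        rw [hq]
        exact (mem_valueSpace_iff.1 (hf w)).1
    · intro α a
      have : f.compLinearMap (fun _ => (torusAct α).toLinearMap) =
          (torusAct α).toLinearMap.compMultilinearMap f := by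
        refine cochain_ext fun w => ?_
        simp only [MultilinearMap.compLinearMap_apply, LinearMap.compMultilinearMap_apply,
          AlgHom.toLinearMap_apply, letters, torusAct_mono]
        rw [MultilinearMap.map_smul_univ, prod_prod_eq_prod_pow_weight]
        exact ((mem_valueSpace_iff.1 (hf w)).2 α).symm
      exact congrFun (congrArg DFunLike.coe this) a

/-- The multiplicity function of a subset. -/
def indicator {n : ℕ} (J : Finset (Fin (n + 2))) : Fin (n + 2) → ℕ :=
  fun i => if i ∈ J then 1 else 0

theorem allowed_union {n : ℕ} {t : ℚ} {m : Fin (n + 2) → ℕ} {J K : Finset (Fin (n + 2))}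
    (hd : Disjoint J K) (hK : Allowed t m K) : Allowed t (indicator J + m) (J ∪ K) := by
  constructor
  · rw [Finset.card_union_of_disjoint hd]
    have : ∑ i, indicator J i = J.card := by simp [indicator]
    simp only [Pi.add_apply, Finset.sum_add_distrib, this]
    push_cast
    have := hK.1
    push_cast at this
    linear_combination this
  · intro α
    rw [Finset.prod_union hd, hK.2 α]
    simp only [Pi.add_apply, pow_add, Finset.prod_mul_distrib]
    congr 1
    simp [indicator, pow_ite, Finset.prod_ite_mem]

theorem mono_mul_mem_valueSpace {n : ℕ} {t : ℚ} {m : Fin (n + 2) → ℕ} (J : Finset (Fin (n + 2)))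
    {x : A n} (hx : x ∈ valueSpace t m) : mono n J * x ∈ valueSpace t (indicator J + m) := by
  refine Submodule.span_induction ?_ (by simp) (fun x y _ _ hx hy => ?_) (fun c x _ hx => ?_) hx
  · rintro _ ⟨K, hK, rfl⟩
    by_cases hd : Disjoint J K
    · obtain ⟨c, -, hc⟩ := exists_mono_mul_of_disjoint hd
      rw [hc]
      exact Submodule.smul_mem _ _ (Submodule.subset_span ⟨_, allowed_union hd hK, rfl⟩)
    · rw [mono_mul_of_not_disjoint hd]
      exact zero_mem _
  · rw [mul_add]
    exact add_mem hx hy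
  · rw [mul_smul_comm]
    exact Submodule.smul_mem _ _ hx

theorem mul_mono_mem_valueSpace {n : ℕ} {t : ℚ} {m : Fin (n + 2) → ℕ} (J : Finset (Fin (n + 2)))
    {x : A n} (hx : x ∈ valueSpace t m) : x * mono n J ∈ valueSpace t (indicator J + m) := by
  refine Submodule.span_induction ?_ (by simp) (fun x y _ _ hx hy => ?_) (fun c x _ hx => ?_) hx
  · rintro _ ⟨K, hK, rfl⟩
    by_cases hd : Disjoint K J
    · obtain ⟨c, -, hc⟩ := exists_mono_mul_of_disjoint hd
      rw [hc, Finset.union_comm]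
      exact Submodule.smul_mem _ _ (Submodule.subset_span ⟨_, allowed_union hd.symm hK, rfl⟩)
    · rw [mono_mul_of_not_disjoint hd]
      exact zero_mem _
  · rw [add_mul]
    exact add_mem hx hy
  · rw [smul_mul_assoc]
    exact Submodule.smul_mem _ _ hx

theorem parity_mem_valueSpace {n : ℕ} {t : ℚ} {m : Fin (n + 2) → ℕ}
    {x : A n} (hx : x ∈ valueSpace t m) : parity n x ∈ valueSpace t m := by
  refine Submodule.span_induction ?_ (by simp) (fun x y _ _ hx hy => ?_) (fun c x _ hx => ?_) hx
  · rintro _ ⟨K, hK, rfl⟩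
    rw [parity_mono]
    exact Submodule.smul_mem _ _ (Submodule.subset_span ⟨_, hK, rfl⟩)
  · rw [map_add]
    exact add_mem hx hy
  · rw [map_smul]
    exact Submodule.smul_mem _ _ hx

/-! ### Merging neighbouring letters of a word -/

/-- The word obtained by replacing the letters `i` and `i + 1` by their union. -/
def merge {n s : ℕ} (i : Fin s) (u : Word n (s + 1)) : Word n s :=
  Fin.contractNth i.castSucc (· ∪ ·) u

theorem merge_apply {n s : ℕ} (i : Fin s) (u : Word n (s + 1)) (j : Fin s) :
    merge i u j = if j < i then u j.castSucc else
      if j = i then u j.castSucc ∪ u j.succ else u j.succ := by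
  simp only [merge, Fin.contractNth, Fin.val_castSucc, Fin.lt_def, Fin.ext_iff]

theorem merge_of_lt {n s : ℕ} {i j : Fin s} (u : Word n (s + 1)) (h : j < i) :
    merge i u j = u j.castSucc := by
  rw [merge_apply, if_pos h]

theorem merge_self {n s : ℕ} (i : Fin s) (u : Word n (s + 1)) :
    merge i u i = u i.castSucc ∪ u i.succ := by
  rw [merge_apply, if_neg (lt_irrefl _), if_pos rfl]

theorem merge_of_gt {n s : ℕ} {i j : Fin s} (u : Word n (s + 1)) (h : i < j) :
    merge i u j = u j.succ := by
  rw [merge_apply, if_neg h.not_gt, if_neg h.ne']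

theorem merge_succ_zero {n s : ℕ} (i : Fin s) (u : Word n (s + 2)) : merge i.succ u 0 = u 0 :=
  merge_of_lt u (Fin.succ_pos i)

theorem merge_succ_succ {n s : ℕ} (i j : Fin s) (u : Word n (s + 2)) :
    merge i.succ u j.succ = merge i (Fin.tail u) j := by
  simp [merge_apply, Fin.tail]

theorem sum_merge {n s : ℕ} (i : Fin s) (u : Word n (s + 1)) (g : Finset (Fin (n + 2)) → ℕ)
    (hg : g (u i.castSucc ∪ u i.succ) = g (u i.castSucc) + g (u i.succ)) :
    ∑ j, g (merge i u j) = ∑ j, g (u j) := by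
  induction s with
  | zero => exact i.elim0
  | succ s ih =>
    induction i using Fin.cases with
    | zero =>
      rw [Fin.sum_univ_succ, merge_self, hg, Fin.sum_univ_succ (n := s + 1), Fin.sum_univ_succ,
        add_assoc]
      simp only [merge_of_gt u (Fin.succ_pos _)]
      rfl
    | succ i =>
      rw [Fin.sum_univ_succ, Fin.sum_univ_succ (n := s + 1), merge_succ_zero]
      simp only [merge_succ_succ]
      rw [ih i (Fin.tail u) hg]
      rfl

theorem weight_merge {n s : ℕ} (i : Fin s) (u : Word n (s + 1))
    (h : Disjoint (u i.castSucc) (u i.succ)) : weight (merge i u) = weight u := by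
  ext x
  refine sum_merge i u (fun J => if x ∈ J then 1 else 0) ?_
  have hx : x ∈ u i.castSucc → x ∉ u i.succ := fun hx => Finset.disjoint_left.1 h hx
  by_cases h1 : x ∈ u i.castSucc
  · simp [h1, hx h1]
  · simp [h1]

/-! ### Inversions -/

/-- The number of inversions between two letters. -/
def inv {n : ℕ} (J K : Finset (Fin (n + 2))) : ℕ := {p ∈ J ×ˢ K | p.2 < p.1}.card

theorem inv_union_left {n : ℕ} {J K : Finset (Fin (n + 2))} (h : Disjoint J K)
    (L : Finset (Fin (n + 2))) : inv (J ∪ K) L = inv J L + inv K L := by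
  rw [inv, Finset.union_product, Finset.filter_union, Finset.card_union_of_disjoint]
  · rfl
  · exact Finset.disjoint_filter_filter (Finset.disjoint_product.2 (Or.inl h))

theorem inv_union_right {n : ℕ} {J K : Finset (Fin (n + 2))} (h : Disjoint J K)
    (L : Finset (Fin (n + 2))) : inv L (J ∪ K) = inv L J + inv L K := by
  rw [inv, Finset.product_union, Finset.filter_union, Finset.card_union_of_disjoint]
  · rfl
  · exact Finset.disjoint_filter_filter (Finset.disjoint_product.2 (Or.inr h))

theorem inv_eq_zero_iff {n : ℕ} {J K : Finset (Fin (n + 2))} :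
    inv J K = 0 ↔ ∀ x ∈ J, ∀ y ∈ K, x ≤ y := by
  rw [inv, Finset.card_eq_zero, Finset.filter_eq_empty_iff]
  constructor
  · intro h x hx y hy
    exact not_lt.1 (@h (x, y) (Finset.mk_mem_product hx hy))
  · rintro h ⟨x, y⟩ hp
    rw [Finset.mem_product] at hp
    exact not_lt.2 (h x hp.1 y hp.2)

/-- The number of generators in a word plus the number of its inversions. -/
def complexity {n : ℕ} : {s : ℕ} → Word n s → ℕ
  | 0, _ => 0
  | _ + 1, u => (u 0).card + ∑ j, inv (u 0) (Fin.tail u j) + complexity (Fin.tail u)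

theorem complexity_tail {n s : ℕ} (u : Word n (s + 1)) :
    complexity (Fin.tail u) + (u 0).card ≤ complexity u := by
  rw [complexity]
  omega

theorem complexity_init {n s : ℕ} (u : Word n (s + 1)) :
    complexity (Fin.init u) + (u (Fin.last s)).card ≤ complexity u := by
  induction s with
  | zero => simp [complexity]
  | succ s ih =>
    have := ih (Fin.tail u)
    rw [complexity, complexity, Fin.sum_univ_castSucc (f := fun j => inv (u 0) (Fin.tail u j))]
    have e : Fin.tail (Fin.init u) = Fin.init (Fin.tail u) := rfl
    rw [e]
    have e2 : ∑ j, inv (Fin.init u 0) (Fin.init (Fin.tail u) j) =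
      ∑ j : Fin s, inv (u 0) (Fin.tail u j.castSucc) := rfl
    have e3 : Fin.init u 0 = u 0 := rfl
    have e4 : Fin.tail u (Fin.last s) = u (Fin.last (s + 1)) := rfl
    rw [e4] at this
    rw [e2, e3]
    omega

theorem complexity_merge {n s : ℕ} (i : Fin s) (u : Word n (s + 1))
    (h : Disjoint (u i.castSucc) (u i.succ)) :
    complexity (merge i u) + inv (u i.castSucc) (u i.succ) = complexity u := by
  induction s with
  | zero => exact i.elim0
  | succ s ih =>
    induction i using Fin.cases with
    | zero =>
      have e : Fin.tail (merge 0 u) = Fin.tail (Fin.tail u) := by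
        ext1 j
        exact merge_of_gt u (Fin.succ_pos j)
      rw [complexity, e, complexity, complexity, merge_self, Finset.card_union_of_disjoint h,
        Fin.sum_univ_succ]
      simp only [inv_union_left h, Finset.sum_add_distrib]
      simp only [Fin.tail, Fin.castSucc_zero]
      omega
    | succ i =>
      have e : Fin.tail (merge i.succ u) = merge i (Fin.tail u) := by
        ext1 j
        exact merge_succ_succ i j u
      have h' : Disjoint (Fin.tail u i.castSucc) (Fin.tail u i.succ) := h
      have := ih i (Fin.tail u) h'
      rw [complexity, e, complexity, merge_succ_zero, ← this,
        sum_merge i (Fin.tail u) (inv (u 0)) (inv_union_right h' _)]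
      simp only [Fin.tail, Fin.succ_castSucc]
      omega

/-! ### The matching on words -/

/-- The word `u` begins with singletons `u_0 ≥ ⋯ ≥ u_k` followed by a letter `u_{k+1}` all of whose
elements are larger than `u_k`, and no letter is empty. -/
structure IsAscentAt {n s : ℕ} (k : Fin s) (u : Word n (s + 1)) : Prop where
  nonempty : ∀ j, (u j).Nonempty
  card_eq_one : ∀ j, j.val ≤ k.val → (u j).card = 1
  le : ∀ i, i < k → ∀ x ∈ u i.castSucc, ∀ y ∈ u i.succ, y ≤ x
  lt : ∀ x ∈ u k.castSucc, ∀ y ∈ u k.succ, x < y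

/-- The first maximal run of empty letters of `u` starts at position `k`, and it consists of `r`
letters. -/
structure IsUnitRun {n s : ℕ} (k r : ℕ) (u : Word n s) : Prop where
  pos : 0 < r
  le : k + r ≤ s
  before : ∀ j : Fin s, j.val < k → (u j).Nonempty
  run : ∀ j : Fin s, k ≤ j.val → j.val < k + r → u j = ∅
  after : ∀ j : Fin s, j.val = k + r → (u j).Nonempty

/-- `u` is an upper word of the matching, matched with the lower word `merge k u`: either `u` has
an ascent at `k`, or the first run of empty letters of `u` starts at `k` and has even length. -/
def IsUpperAt {n s : ℕ} (k : Fin s) (u : Word n (s + 1)) : Prop :=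
  IsAscentAt k u ∨ ∃ r, Even r ∧ IsUnitRun k r u

/-- `w` is an upper word of the matching. -/
def IsUpper {n : ℕ} : {s : ℕ} → Word n s → Prop
  | 0, _ => False
  | _ + 1, u => ∃ k, IsUpperAt k u

/-- `w` is a critical (that is, unmatched) word: a weakly decreasing sequence of generators. -/
def IsCritical {n s : ℕ} (w : Word n s) : Prop :=
  ∃ I : Fin s → Fin (n + 2), Antitone I ∧ w = fun j => {I j}

theorem exists_least {P : ℕ → Prop} (h : ∃ k, P k) : ∃ k, P k ∧ ∀ j < k, ¬P j := by
  classical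
  exact ⟨Nat.find h, Nat.find_spec h, fun j hj => Nat.find_min h hj⟩

theorem exists_isUnitRun {n s : ℕ} {w : Word n s} (h : ∃ j, w j = ∅) :
    ∃ k r, IsUnitRun k r w := by
  classical
  have h1 : ∃ k : ℕ, ∃ hk : k < s, w ⟨k, hk⟩ = ∅ := by
    obtain ⟨j, hj⟩ := h
    exact ⟨j, j.2, hj⟩
  obtain ⟨k, ⟨hks, hk⟩, hkmin⟩ := exists_least h1
  have h2 : ∃ r : ℕ, ∀ h : k + r < s, (w ⟨k + r, h⟩).Nonempty := ⟨s, fun h => by omega⟩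
  obtain ⟨r, hr, hrmin⟩ := exists_least h2
  have hrun : ∀ r' < r, ∃ h : k + r' < s, w ⟨k + r', h⟩ = ∅ := by
    intro r' hr'
    have := hrmin r' hr'
    push Not at this
    exact this
  have hpos : 0 < r := by
    rw [Nat.pos_iff_ne_zero]
    intro h0
    subst h0
    exact (hr hks).ne_empty hk
  refine ⟨k, r, hpos, ?_, ?_, ?_, ?_⟩
  · obtain ⟨h, -⟩ := hrun (r - 1) (by omega)
    omega
  · intro j hj
    by_contra hne
    exact hkmin _ hj ⟨j.2, Finset.not_nonempty_iff_eq_empty.1 hne⟩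
  · intro j hj1 hj2
    obtain ⟨h, h'⟩ := hrun (j.val - k) (by omega)
    rw [← h']
    congr 1
    ext
    simp
    omega
  · intro j hj
    have := hr (by omega)
    convert this

/-- A word with an empty letter is upper or lower. -/
theorem isUpper_or_exists_of_isUnitRun {n s k r : ℕ} {w : Word n s} (h : IsUnitRun k r w) :
    IsUpper w ∨ ∃ (u : Word n (s + 1)) (k : Fin s), IsUpperAt k u ∧ merge k u = w := by
  have hpos := h.pos
  have hle := h.le
  rcases Nat.even_or_odd r with hr | hr
  · left
    have : r ≠ 1 := by
      rintro rfl
      exact Nat.not_even_one hr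
    obtain ⟨s, rfl⟩ : ∃ s', s = s' + 1 := ⟨s - 1, by omega⟩
    exact ⟨⟨k, by omega⟩, Or.inr ⟨r, hr, h⟩⟩
  · right
    refine ⟨fun j => if hj : j.val ≤ k then w ⟨j, by omega⟩ else w ⟨j.val - 1, by omega⟩,
      ⟨k, by omega⟩, Or.inr ⟨r + 1, hr.add_one, by omega, by simp only; omega, ?_, ?_, ?_⟩, ?_⟩
    · intro j hj
      simp only at hj
      rw [dif_pos hj.le]
      exact h.before _ hj
    · intro j hj1 hj2
      simp only at hj1 hj2
      split_ifs with hj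
      · exact h.run _ hj1 (by simp only; omega)
      · exact h.run _ (by simp only; omega) (by simp only; omega)
    · intro j hj
      simp only at hj
      rw [dif_neg (by omega)]
      exact h.after _ (by simp only; omega)
    · ext1 j
      rw [merge_apply]
      simp only [Fin.lt_def, Fin.ext_iff, Fin.val_castSucc, Fin.val_succ]
      rcases lt_trichotomy j.val k with hj | hj | hj
      · rw [if_pos hj, dif_pos hj.le]
      · rw [if_neg hj.not_lt, if_pos hj, dif_pos hj.le, dif_neg (by omega)]
        exact Finset.union_self _
      · rw [if_neg hj.not_gt, if_neg hj.ne', dif_neg (by omega)]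
        rfl

theorem singleton_min'_union_erase {α : Type*} [LinearOrder α] (J : Finset α) (hJ : J.Nonempty) :
    {J.min' hJ} ∪ J.erase (J.min' hJ) = J := by
  rw [← Finset.insert_eq, Finset.insert_erase (Finset.min'_mem _ _)]

/-- A word without empty letters is upper, critical or lower. -/
theorem isUpper_or_isCritical_or_exists_of_nonempty {n s : ℕ} {w : Word n s}
    (hne : ∀ j, (w j).Nonempty) : IsUpper w ∨ IsCritical w ∨
      ∃ (u : Word n (s + 1)) (k : Fin s), IsUpperAt k u ∧ merge k u = w := by
  classical
  by_cases hbad : ∃ k : ℕ, ∃ hk : k < s, ¬((w ⟨k, hk⟩).card = 1 ∧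
      ∀ i : Fin s, i.val + 1 = k → ∀ x ∈ w i, ∀ y ∈ w ⟨k, hk⟩, y ≤ x)
  swap
  · push Not at hbad
    right; left
    have h1 : ∀ j, ∃ x, w j = {x} := fun j => Finset.card_eq_one.1 (hbad j j.2).1
    choose I hI using h1
    refine ⟨I, ?_, funext hI⟩
    cases s with
    | zero => exact fun i => i.elim0
    | succ s =>
      rw [Fin.antitone_iff_succ_le]
      intro i
      refine (hbad _ i.succ.2).2 i.castSucc rfl _ ?_ _ ?_
      · rw [hI]; simp
      · rw [Fin.eta, hI]; simp
  obtain ⟨k, ⟨hks, hk⟩, hkmin⟩ := exists_least hbad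
  have hgood : ∀ j : Fin s, j.val < k → (w j).card = 1 ∧
      ∀ i : Fin s, i.val + 1 = j.val → ∀ x ∈ w i, ∀ y ∈ w j, y ≤ x := by
    intro j hj
    have := hkmin _ hj
    push Not at this
    exact this j.2
  by_cases hup : ∃ i : Fin s, i.val + 1 = k ∧ ∀ x ∈ w i, ∀ y ∈ w ⟨k, hks⟩, x < y
  · left
    obtain ⟨i, hi, hlt⟩ := hup
    obtain ⟨s, rfl⟩ : ∃ s', s = s' + 1 := ⟨s - 1, by omega⟩
    refine ⟨⟨i, by omega⟩, Or.inl ⟨hne, ?_, ?_, ?_⟩⟩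
    · intro j hj
      exact (hgood j (by simp only at hj; omega)).1
    · intro i' hi'
      rw [Fin.lt_def] at hi'
      simp only at hi'
      exact (hgood i'.succ (by simp; omega)).2 i'.castSucc (by simp)
    · intro x hx y hy
      refine hlt x hx y ?_
      convert hy
      simp [hi]
  · right; right
    push Not at hup
    set m := (w ⟨k, hks⟩).min' (hne _) with hm
    have hcard : 2 ≤ (w ⟨k, hks⟩).card := by
      by_contra hlt
      have h1 : (w ⟨k, hks⟩).card = 1 := by
        have := (hne ⟨k, hks⟩).card_pos
        omega
      apply hk
      refine ⟨h1, fun i hi x hx y hy => ?_⟩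
      obtain ⟨x', hx', y', hy', hle⟩ := hup i hi
      rw [Finset.card_le_one.1 (hgood i (by omega)).1.le x hx x' hx',
        Finset.card_le_one.1 h1.le y hy y' hy']
      exact hle
    refine ⟨fun j => if hj : j.val < k then w ⟨j, by omega⟩ else if j.val = k then {m} else
      if j.val = k + 1 then (w ⟨k, hks⟩).erase m else w ⟨j.val - 1, by omega⟩,
      ⟨k, hks⟩, Or.inl ⟨?_, ?_, ?_, ?_⟩, ?_⟩
    · intro j
      split_ifs
      · exact hne _
      · simp
      · rw [← Finset.card_pos, Finset.card_erase_of_mem (Finset.min'_mem _ _)]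
        omega
      · exact hne _
    · intro j hj
      simp only at hj
      split_ifs with h1 h2 h3
      · exact (hgood ⟨j, by omega⟩ h1).1
      · simp
      · omega
      · omega
    · intro i hi x hx y hy
      rw [Fin.lt_def] at hi
      simp only [Fin.val_castSucc, Fin.val_succ] at hi hx hy
      rw [dif_pos hi] at hx
      by_cases h1 : i.val + 1 < k
      · rw [dif_pos h1] at hy
        exact (hgood ⟨i.val + 1, by omega⟩ h1).2 i rfl x hx y hy
      · rw [dif_neg h1, if_pos (by omega), Finset.mem_singleton] at hy
        obtain ⟨x', hx', y', hy', hle⟩ := hup i (by omega)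
        rw [hy, Finset.card_le_one.1 (hgood i hi).1.le x hx x' hx']
        exact (Finset.min'_le _ _ hy').trans hle
    · intro x hx y hy
      simp only [Fin.val_castSucc, Fin.val_succ] at hx hy
      simp only [lt_irrefl, dite_false, if_true, Finset.mem_singleton] at hx
      rw [dif_neg (by omega), if_neg (by omega), if_pos trivial] at hy
      rw [hx]
      exact Finset.min'_lt_of_mem_erase_min' _ _ hy
    · ext1 j
      rw [merge_apply]
      simp only [Fin.lt_def, Fin.ext_iff, Fin.val_castSucc, Fin.val_succ]
      by_cases h1 : j.val < k
      · rw [if_pos h1, dif_pos h1]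
      · rw [if_neg h1]
        by_cases h2 : j.val = k
        · rw [if_pos h2, dif_neg h1, if_pos h2, dif_neg (by omega), if_neg (by omega),
            if_pos (by omega), singleton_min'_union_erase]
          congr 1
          exact Fin.ext h2.symm
        · rw [if_neg h2, dif_neg (by omega), if_neg (by omega), if_neg (by omega)]
          rfl

/-- Every word is upper, critical or lower. -/
theorem isUpper_or_isCritical_or_exists {n s : ℕ} (w : Word n s) :
    IsUpper w ∨ IsCritical w ∨
      ∃ (u : Word n (s + 1)) (k : Fin s), IsUpperAt k u ∧ merge k u = w := by
  by_cases h : ∃ j, w j = ∅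
  · obtain ⟨k, r, hkr⟩ := exists_isUnitRun h
    exact (isUpper_or_exists_of_isUnitRun hkr).imp_right Or.inr
  · push Not at h
    exact isUpper_or_isCritical_or_exists_of_nonempty h

theorem IsUnitRun.unique {n s k r k' r' : ℕ} {w : Word n s} (h : IsUnitRun k r w)
    (h' : IsUnitRun k' r' w) : k = k' ∧ r = r' := by
  have hpos := h.pos
  have hpos' := h'.pos
  have hle := h.le
  have hle' := h'.le
  have hk : k = k' := by
    rcases lt_trichotomy k k' with hlt | heq | hlt
    · exact absurd (h.run ⟨k, by omega⟩ le_rfl (by simp only; omega)) (h'.before _ hlt).ne_empty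
    · exact heq
    · exact absurd (h'.run ⟨k', by omega⟩ le_rfl (by simp only; omega)) (h.before _ hlt).ne_empty
  subst hk
  refine ⟨rfl, ?_⟩
  rcases lt_trichotomy r r' with hlt | heq | hlt
  · exact absurd (h'.run ⟨k + r, by omega⟩ (by simp) (by simp only; omega))
      (h.after _ rfl).ne_empty
  · exact heq
  · exact absurd (h.run ⟨k + r', by omega⟩ (by simp) (by simp only; omega))
      (h'.after _ rfl).ne_empty

theorem IsUnitRun.one_lt {n s k r : ℕ} {w : Word n s} (h : IsUnitRun k r w) (hr : Even r) :
    1 < r := by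
  have := h.pos
  obtain ⟨a, rfl⟩ := hr
  omega

theorem IsUnitRun.exists_eq_empty {n s k r : ℕ} {w : Word n s} (h : IsUnitRun k r w) :
    ∃ j : Fin s, j.val = k ∧ w j = ∅ := by
  have hpos := h.pos
  have hle := h.le
  exact ⟨⟨k, by omega⟩, rfl, h.run _ le_rfl (by simp only; omega)⟩

/-- Merging the first two letters of the first run of empty letters shortens the run by one. -/
theorem IsUnitRun.isUnitRun_merge {n s r : ℕ} {k : Fin s} {u : Word n (s + 1)} (h : IsUnitRun k r u)
    (hr : 1 < r) : IsUnitRun k (r - 1) (merge k u) := by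
  have hle := h.le
  refine ⟨by omega, by omega, ?_, ?_, ?_⟩
  · intro j hj
    rw [merge_of_lt u hj]
    exact h.before _ hj
  · intro j hj1 hj2
    rcases hj1.eq_or_lt with hj | hj
    · obtain rfl : k = j := Fin.ext hj
      rw [merge_self, h.run _ (by simp) (by simp; omega), h.run _ (by simp) (by simp; omega)]
      simp
    · rw [merge_of_gt u hj, h.run _ (by simp; omega) (by simp; omega)]
  · intro j hj
    rw [merge_of_gt u (by rw [Fin.lt_def]; omega)]
    exact h.after _ (by simp; omega)

theorem merge_nonempty {n s : ℕ} {u : Word n (s + 1)} (h : ∀ j, (u j).Nonempty) (i j : Fin s) :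
    (merge i u j).Nonempty := by
  rw [merge_apply]
  split_ifs
  · exact h _
  · exact (h _).mono Finset.subset_union_left
  · exact h _

theorem IsAscentAt.disjoint {n s : ℕ} {k : Fin s} {u : Word n (s + 1)} (h : IsAscentAt k u) :
    Disjoint (u k.castSucc) (u k.succ) :=
  Finset.disjoint_left.2 fun x hx hy => lt_irrefl x (h.lt x hx x hy)

theorem IsAscentAt.two_le_card {n s : ℕ} {k : Fin s} {u : Word n (s + 1)} (h : IsAscentAt k u) :
    2 ≤ (merge k u k).card := by
  rw [merge_self, Finset.card_union_of_disjoint h.disjoint]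
  have h1 := (h.nonempty k.castSucc).card_pos
  have h2 := (h.nonempty k.succ).card_pos
  omega

theorem IsAscentAt.card_merge {n s : ℕ} {k j : Fin s} {u : Word n (s + 1)} (h : IsAscentAt k u)
    (hj : j < k) : (merge k u j).card = 1 := by
  rw [merge_of_lt u hj]
  exact h.card_eq_one _ (by simpa using (Fin.lt_def.1 hj).le)

/-- An upper word is determined by the lower word it is matched with. -/
theorem eq_of_merge_eq {n s : ℕ} {k k' : Fin s} {u u' : Word n (s + 1)} (h : IsUpperAt k u)
    (h' : IsUpperAt k' u') (he : merge k u = merge k' u') : u = u' := by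
  have key : k = k' → u k.castSucc = u' k.castSucc → u k.succ = u' k.succ → u = u' := by
    rintro rfl h1 h2
    ext1 j
    rcases lt_trichotomy j.val k.val with hj | hj | hj
    · have := congrFun he ⟨j, by omega⟩
      rwa [merge_of_lt u hj, merge_of_lt u' hj] at this
    · obtain rfl : j = k.castSucc := Fin.ext hj
      exact h1
    · rcases (Nat.succ_le_of_lt hj).eq_or_lt with hj' | hj'
      · obtain rfl : j = k.succ := Fin.ext hj'.symm
        exact h2
      · have := congrFun he ⟨j.val - 1, by omega⟩
        have hlt : k < ⟨j.val - 1, by omega⟩ := by rw [Fin.lt_def]; simp only; omega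
        rw [merge_of_gt u hlt, merge_of_gt u' hlt] at this
        convert this using 2 <;> · ext; simp; omega
  rcases h with h | ⟨r, hr, h⟩ <;> rcases h' with h' | ⟨r', hr', h'⟩
  · have hk : k = k' := by
      rcases lt_trichotomy k k' with hlt | heq | hlt
      · have := h.two_le_card
        rw [he, h'.card_merge hlt] at this
        omega
      · exact heq
      · have := h'.two_le_card
        rw [← he, h.card_merge hlt] at this
        omega
    subst hk
    obtain ⟨x, hx⟩ := Finset.card_eq_one.1 (h.card_eq_one k.castSucc (by simp))
    obtain ⟨x', hx'⟩ := Finset.card_eq_one.1 (h'.card_eq_one k.castSucc (by simp))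
    have hu := congrFun he k
    have hlt := h.lt
    have hlt' := h'.lt
    rw [merge_self, merge_self, hx, hx'] at hu
    rw [hx] at hlt
    rw [hx'] at hlt'
    simp only [Finset.mem_singleton, forall_eq] at hlt hlt'
    have hxx : x = x' := by
      have h1 : x ∈ {x'} ∪ u' k.succ := hu ▸ Finset.mem_union_left _ (Finset.mem_singleton_self x)
      have h2 : x' ∈ {x} ∪ u k.succ := hu ▸ Finset.mem_union_left _ (Finset.mem_singleton_self x')
      rw [Finset.mem_union, Finset.mem_singleton] at h1 h2
      rcases h1 with h1 | h1
      · exact h1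
      · rcases h2 with h2 | h2
        · exact h2.symm
        · exact absurd (hlt x' h2) (hlt' x h1).not_gt
    subst hxx
    refine key rfl (hx.trans hx'.symm) ?_
    ext y
    have hy := Finset.ext_iff.1 hu y
    simp only [Finset.mem_union, Finset.mem_singleton] at hy
    by_cases hyx : y = x
    · subst hyx
      exact iff_of_false (fun h => lt_irrefl _ (hlt y h)) (fun h => lt_irrefl _ (hlt' y h))
    · simpa [hyx] using hy
  · have hr2 := h'.one_lt hr'
    obtain ⟨j, -, hj⟩ := (h'.isUnitRun_merge hr2).exists_eq_empty
    exact absurd (he ▸ hj) (merge_nonempty h.nonempty k j).ne_empty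
  · have hr2 := h.one_lt hr
    obtain ⟨j, -, hj⟩ := (h.isUnitRun_merge hr2).exists_eq_empty
    exact absurd (he ▸ hj) (merge_nonempty h'.nonempty k' j).ne_empty
  · have hr2 := h.one_lt hr
    have hr2' := h'.one_lt hr'
    have hk : k = k' := Fin.ext ((h.isUnitRun_merge hr2).unique (he ▸ h'.isUnitRun_merge hr2')).1
    subst hk
    refine key rfl ?_ ?_
    · rw [h.run _ (by simp) (by simp; omega), h'.run _ (by simp) (by simp; omega)]
    · rw [h.run _ (by simp) (by simp; omega), h'.run _ (by simp) (by simp; omega)]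

/-- A word matched with an upper word is not critical. -/
theorem not_isCritical_merge {n s : ℕ} {k : Fin s} {u : Word n (s + 1)} (h : IsUpperAt k u) :
    ¬IsCritical (merge k u) := by
  rintro ⟨I, -, hI⟩
  rcases h with h | ⟨r, hr, h⟩
  · have := h.two_le_card
    rw [hI] at this
    simp at this
  · have hr2 := h.one_lt hr
    obtain ⟨j, -, hj⟩ := (h.isUnitRun_merge hr2).exists_eq_empty
    rw [hI] at hj
    simp at hj

/-- A word matched with an upper word is not upper itself. -/
theorem not_isUpper_merge {n s : ℕ} {k : Fin s} {u : Word n (s + 1)} (h : IsUpperAt k u) :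
    ¬IsUpper (merge k u) := by
  cases s with
  | zero => exact k.elim0
  | succ s =>
  rintro ⟨k', h'⟩
  rcases h with h | ⟨r, hr, h⟩
  · rcases h' with h' | ⟨r', -, h'⟩
    · have hkk : k'.castSucc < k := by
        by_contra hle
        rw [not_lt] at hle
        have := h.two_le_card
        rw [h'.card_eq_one k hle] at this
        omega
      obtain ⟨x, hx⟩ := h'.nonempty k'.castSucc
      have hx' := hx
      rw [merge_of_lt u hkk] at hx'
      rcases (Fin.castSucc_lt_iff_succ_le.1 hkk).eq_or_lt with hk | hk
      · obtain ⟨y, hy⟩ := h.nonempty k'.succ.castSucc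
        refine absurd (h.le k'.castSucc hkk x hx' y hy) (not_le.2 (h'.lt x hx y ?_))
        rw [hk, merge_self, ← hk]
        exact Finset.mem_union_left _ hy
      · obtain ⟨y, hy⟩ := h'.nonempty k'.succ
        refine absurd (h.le k'.castSucc hkk x hx' y ?_) (not_le.2 (h'.lt x hx y hy))
        rwa [merge_of_lt u hk] at hy
    · obtain ⟨j, -, hj⟩ := h'.exists_eq_empty
      exact (merge_nonempty h.nonempty k j).ne_empty hj
  · have hr2 := h.one_lt hr
    rcases h' with h' | ⟨r', hr', h'⟩
    · obtain ⟨j, -, hj⟩ := (h.isUnitRun_merge hr2).exists_eq_empty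
      exact (h'.nonempty j).ne_empty hj
    · have := ((h.isUnitRun_merge hr2).unique h').2
      obtain ⟨a, rfl⟩ := hr
      obtain ⟨b, rfl⟩ := hr'
      omega

/-! ### The square of the Hochschild differential -/

theorem leftTerm_apply {n s : ℕ} (f : Cochain n s) (a : Fin (s + 1) → A n) :
    leftTerm f a = evenPart n (a 0) * f (Fin.tail a) +
      oddPart n (a 0) * conjParity f (Fin.tail a) := rfl

theorem innerTerm_apply {n s : ℕ} (i : Fin s) (f : Cochain n s) (a : Fin (s + 1) → A n) :
    innerTerm i f a = f (Fin.contractNth i.castSucc (· * ·) a) := rfl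

theorem rightTerm_apply {n s : ℕ} (f : Cochain n s) (a : Fin (s + 1) → A n) :
    rightTerm f a = f (Fin.init a) * a (Fin.last s) := rfl

theorem conjParity_apply {n s : ℕ} (f : Cochain n s) (a : Fin s → A n) :
    conjParity f a = parity n (f fun i => parity n (a i)) := rfl

/-- The `i`-th coface map of the Hochschild complex, for `0 ≤ i ≤ s + 1`. -/
def face {n s : ℕ} (i : ℕ) (f : Cochain n s) : Cochain n (s + 1) :=
  if i = 0 then leftTerm f else if h : i - 1 < s then innerTerm ⟨i - 1, h⟩ f else rightTerm f

theorem face_zero {n s : ℕ} (f : Cochain n s) : face 0 f = leftTerm f := if_pos rfl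

theorem face_succ {n s i : ℕ} (h : i < s) (f : Cochain n s) :
    face (i + 1) f = innerTerm ⟨i, h⟩ f := by
  simp [face, h]

theorem face_last {n s : ℕ} (f : Cochain n s) : face (s + 1) f = rightTerm f := by
  simp [face]

theorem hochDiff_eq_sum_face {n s : ℕ} (f : Cochain n s) :
    hochDiff n s f = ∑ i ∈ Finset.range (s + 2), (-1 : ℂ) ^ i • face i f := by
  rw [Finset.sum_range_succ, Finset.sum_range_succ', face_last, face_zero,
    ← Fin.sum_univ_eq_sum_range (fun i => (-1 : ℂ) ^ (i + 1) • face (i + 1) f)]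
  simp only [face_succ (Fin.is_lt _), Fin.eta, pow_zero, one_smul]
  rw [add_comm (∑ _, _)]
  rfl

theorem face_add {n s : ℕ} (i : ℕ) (f g : Cochain n s) : face i (f + g) = face i f + face i g := by
  unfold face
  split_ifs
  · ext a
    simp only [add_apply, leftTerm_apply, conjParity_apply, map_add, mul_add]
    abel
  · rfl
  · ext a
    simp [rightTerm_apply, add_mul]

theorem face_smul {n s : ℕ} (i : ℕ) (c : ℂ) (f : Cochain n s) : face i (c • f) = c • face i f := by
  unfold face
  split_ifs
  · ext a
    simp only [smul_apply, leftTerm_apply, conjParity_apply, map_smul,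
      mul_smul_comm, smul_add]
  · rfl
  · ext a
    simp [rightTerm_apply]

theorem face_sum {n s : ℕ} (i : ℕ) {ι : Type*} (S : Finset ι) (f : ι → Cochain n s) :
    face i (∑ j ∈ S, f j) = ∑ j ∈ S, face i (f j) :=
  map_sum (AddMonoidHom.mk' (face i) (face_add i)) f S

theorem contractNth_contractNth {R : Type*} [Semigroup R] {s : ℕ} (i j : Fin s) (hij : i ≤ j)
    (a : Fin (s + 2) → R) :
    Fin.contractNth i.castSucc (· * ·) (Fin.contractNth j.succ.castSucc (· * ·) a) =
      Fin.contractNth j.castSucc (· * ·) (Fin.contractNth i.castSucc.castSucc (· * ·) a) := by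
  rw [Fin.le_def] at hij
  ext k
  simp only [Fin.contractNth, Fin.val_castSucc, Fin.val_succ]
  split_ifs <;> first | omega | rfl | simp only [Fin.succ_castSucc, mul_assoc]

theorem parity_parity {n : ℕ} (a : A n) : parity n (parity n a) = a := by
  have : (parity n).comp (parity n) = AlgHom.id ℂ (A n) := by
    rw [parity, ExteriorAlgebra.map_comp_map]
    simp
  exact DFunLike.congr_fun this a

theorem evenPart_apply {n : ℕ} (a : A n) : evenPart n a = (1 / 2 : ℂ) • (a + parity n a) := rfl

theorem oddPart_apply {n : ℕ} (a : A n) : oddPart n a = (1 / 2 : ℂ) • (a - parity n a) := rfl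

theorem parity_evenPart {n : ℕ} (a : A n) : parity n (evenPart n a) = evenPart n a := by
  rw [evenPart_apply, map_smul, map_add, parity_parity, add_comm (parity n a)]

theorem parity_oddPart {n : ℕ} (a : A n) : parity n (oddPart n a) = -oddPart n a := by
  rw [oddPart_apply, map_smul, map_sub, parity_parity, ← smul_neg, neg_sub]

theorem evenPart_parity {n : ℕ} (a : A n) : evenPart n (parity n a) = evenPart n a := by
  rw [evenPart_apply, evenPart_apply, parity_parity, add_comm (parity n a)]

theorem oddPart_parity {n : ℕ} (a : A n) : oddPart n (parity n a) = -oddPart n a := by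
  rw [oddPart_apply, oddPart_apply, parity_parity, ← smul_neg, neg_sub]

theorem evenPart_mul {n : ℕ} (a b : A n) :
    evenPart n (a * b) = evenPart n a * evenPart n b + oddPart n a * oddPart n b := by
  simp only [evenPart_apply, oddPart_apply, map_mul, smul_mul_smul_comm, ← smul_add]
  rw [show (a + parity n a) * (b + parity n b) + (a - parity n a) * (b - parity n b) =
    (2 : ℂ) • (a * b + parity n a * parity n b) by rw [two_smul]; noncomm_ring, smul_smul]
  norm_num

theorem oddPart_mul {n : ℕ} (a b : A n) :
    oddPart n (a * b) = evenPart n a * oddPart n b + oddPart n a * evenPart n b := by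
  simp only [evenPart_apply, oddPart_apply, map_mul, smul_mul_smul_comm, ← smul_add]
  rw [show (a + parity n a) * (b - parity n b) + (a - parity n a) * (b + parity n b) =
    (2 : ℂ) • (a * b - parity n a * parity n b) by rw [two_smul]; noncomm_ring, smul_smul]
  norm_num

theorem conjParity_conjParity {n s : ℕ} (f : Cochain n s) : conjParity (conjParity f) = f := by
  ext a
  simp [conjParity_apply, parity_parity]

theorem conjParity_leftTerm {n s : ℕ} (f : Cochain n s) :
    conjParity (leftTerm f) = leftTerm (conjParity f) := by
  ext a
  have e : (Fin.tail fun i => parity n (a i)) = fun i => parity n (Fin.tail a i) := rfl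
  rw [leftTerm_apply, conjParity_conjParity, conjParity_apply, leftTerm_apply]
  simp only [map_add, map_mul, evenPart_parity, oddPart_parity, parity_evenPart, map_neg,
    parity_oddPart, neg_neg, e, conjParity_apply, parity_parity]

theorem conjParity_innerTerm {n s : ℕ} (i : Fin s) (f : Cochain n s) :
    conjParity (innerTerm i f) = innerTerm i (conjParity f) := by
  ext a
  simp only [conjParity_apply, innerTerm_apply]
  congr 2
  ext1 j
  simp only [Fin.contractNth]
  split_ifs <;> simp

theorem conjParity_rightTerm {n s : ℕ} (f : Cochain n s) :
    conjParity (rightTerm f) = rightTerm (conjParity f) := by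
  ext a
  simp only [conjParity_apply, rightTerm_apply, map_mul, parity_parity]
  rfl

theorem tail_contractNth_succ {R : Type*} [Mul R] {s : ℕ} (i : Fin s) (a : Fin (s + 2) → R) :
    Fin.tail (Fin.contractNth i.succ.castSucc (· * ·) a) =
      Fin.contractNth i.castSucc (· * ·) (Fin.tail a) := by
  ext j
  simp [Fin.tail, Fin.contractNth]

theorem init_contractNth_castSucc {R : Type*} [Mul R] {s : ℕ} (i : Fin s) (a : Fin (s + 2) → R) :
    Fin.init (Fin.contractNth i.castSucc.castSucc (· * ·) a) =
      Fin.contractNth i.castSucc (· * ·) (Fin.init a) := by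
  ext j
  simp [Fin.init, Fin.contractNth]

theorem leftTerm_leftTerm {n s : ℕ} (f : Cochain n s) :
    innerTerm 0 (leftTerm f) = leftTerm (leftTerm f) := by
  ext a
  have e1 : Fin.contractNth (Fin.castSucc 0) (· * ·) a 0 = a 0 * a 1 := rfl
  have e2 : Fin.tail (Fin.contractNth (Fin.castSucc 0) (· * ·) a) = Fin.tail (Fin.tail a) := rfl
  have e3 : Fin.tail a 0 = a 1 := rfl
  rw [innerTerm_apply, leftTerm_apply, leftTerm_apply, conjParity_leftTerm, e1, e2,
    leftTerm_apply, leftTerm_apply, evenPart_mul, oddPart_mul, conjParity_conjParity, e3]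
  noncomm_ring

theorem innerTerm_succ_leftTerm {n s : ℕ} (i : Fin s) (f : Cochain n s) :
    innerTerm i.succ (leftTerm f) = leftTerm (innerTerm i f) := by
  ext a
  have e1 : Fin.contractNth i.succ.castSucc (· * ·) a 0 = a 0 := rfl
  rw [innerTerm_apply, leftTerm_apply, leftTerm_apply, conjParity_innerTerm, e1,
    tail_contractNth_succ, innerTerm_apply, innerTerm_apply]

theorem rightTerm_leftTerm {n s : ℕ} (f : Cochain n s) :
    rightTerm (leftTerm f) = leftTerm (rightTerm f) := by
  ext a
  rw [rightTerm_apply, leftTerm_apply, leftTerm_apply, conjParity_rightTerm, rightTerm_apply,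
    rightTerm_apply, add_mul, mul_assoc, mul_assoc]
  rfl

theorem innerTerm_innerTerm {n s : ℕ} {i j : Fin s} (hij : i ≤ j) (f : Cochain n s) :
    innerTerm j.succ (innerTerm i f) = innerTerm i.castSucc (innerTerm j f) := by
  ext a
  rw [innerTerm_apply, innerTerm_apply, innerTerm_apply, innerTerm_apply,
    contractNth_contractNth i j hij]

theorem rightTerm_innerTerm {n s : ℕ} (i : Fin s) (f : Cochain n s) :
    rightTerm (innerTerm i f) = innerTerm i.castSucc (rightTerm f) := by
  ext a
  have e : Fin.contractNth i.castSucc.castSucc (· * ·) a (Fin.last s) = a (Fin.last (s + 1)) := by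
    rw [Fin.contractNth_apply_of_gt _ _ _ _ (by simp)]
    rfl
  rw [rightTerm_apply, innerTerm_apply, innerTerm_apply, rightTerm_apply, e,
    init_contractNth_castSucc]

theorem rightTerm_rightTerm {n s : ℕ} (f : Cochain n s) :
    rightTerm (rightTerm f) = innerTerm (Fin.last s) (rightTerm f) := by
  ext a
  have e : Fin.contractNth (Fin.last s).castSucc (· * ·) a (Fin.last s) =
      a (Fin.last s).castSucc * a (Fin.last (s + 1)) := by
    rw [Fin.contractNth_apply_of_eq _ _ _ _ (by simp)]
    rfl
  have e2 : Fin.init (Fin.contractNth (Fin.last s).castSucc (· * ·) a) = Fin.init (Fin.init a) := by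
    ext j
    simp [Fin.init, Fin.contractNth]
  rw [rightTerm_apply, rightTerm_apply, innerTerm_apply, rightTerm_apply, e, e2, mul_assoc]
  rfl

/-- The cosimplicial identities. -/
theorem face_face {n s i j : ℕ} (hij : i ≤ j) (hj : j ≤ s + 1) (f : Cochain n s) :
    face (j + 1) (face i f) = face i (face j f) := by
  rcases i with - | i
  · rw [face_zero]
    rcases j with - | j
    · rw [face_zero, face_succ (by omega), face_zero]
      exact leftTerm_leftTerm f
    · rcases (Nat.le_of_succ_le_succ hj).eq_or_lt with h | h
      · subst h
        rw [face_last, face_last, face_zero, rightTerm_leftTerm]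
      · rw [face_succ (by omega), face_succ h, face_zero]
        exact innerTerm_succ_leftTerm ⟨j, h⟩ f
  · rcases j with - | j
    · omega
    · rcases (Nat.le_of_succ_le_succ hj).eq_or_lt with h | h
      · subst h
        rw [face_last, face_last]
        rcases hij.eq_or_lt with h | h
        · obtain rfl : i = j := by omega
          rw [face_last, face_succ (by omega)]
          exact rightTerm_rightTerm f
        · rw [face_succ (by omega), face_succ (by omega)]
          exact rightTerm_innerTerm ⟨i, by omega⟩ f
      · rw [face_succ (by omega), face_succ (by omega), face_succ (by omega), face_succ (by omega)]
        exact innerTerm_innerTerm (i := ⟨i, by omega⟩) (j := ⟨j, h⟩)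
          (Fin.mk_le_mk.2 (by omega)) f

theorem hochDiff_hochDiff {n s : ℕ} (f : Cochain n s) :
    hochDiff n (s + 1) (hochDiff n s f) = 0 := by
  rw [hochDiff_eq_sum_face, hochDiff_eq_sum_face]
  simp only [face_sum, face_smul, Finset.smul_sum, smul_smul, ← pow_add]
  rw [← Finset.sum_product']
  -- the cosimplicial identities pair the terms with `i < j` with those with `j ≤ i`
  refine Finset.sum_involution
    (fun p _ => if p.2 < p.1 then (p.2, p.1 - 1) else (p.2 + 1, p.1)) ?_ ?_ ?_ ?_
  · rintro ⟨j, i⟩ hp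
    simp only [Finset.mem_product, Finset.mem_range] at hp
    split_ifs with h
    · obtain ⟨j, rfl⟩ : ∃ j', j = j' + 1 := ⟨j - 1, by omega⟩
      simp only at h
      simp only [Nat.add_sub_cancel]
      rw [face_face (by omega) (by omega), ← add_smul]
      rw [show j + 1 + i = i + j + 1 by ring, pow_succ]
      simp
    · simp only at h
      simp only
      rw [face_face (by omega) (by omega), ← add_smul]
      rw [show i + 1 + j = j + i + 1 by ring, pow_succ]
      simp
  · rintro ⟨j, i⟩ hp -
    split_ifs with h
    · simp only at h
      simp only [ne_eq, Prod.mk.injEq]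
      omega
    · simp only at h
      simp only [ne_eq, Prod.mk.injEq]
      omega
  · rintro ⟨j, i⟩ hp
    simp only [Finset.mem_product, Finset.mem_range] at hp ⊢
    split_ifs with h
    · simp only
      omega
    · simp only at h ⊢
      omega
  · rintro ⟨j, i⟩ hp
    simp only [Finset.mem_product, Finset.mem_range] at hp
    by_cases h : i < j
    · simp only [h, if_true]
      rw [if_neg (by omega), Nat.sub_add_cancel (by omega)]
    · simp only [h, if_false]
      rw [if_pos (by omega), Nat.add_sub_cancel]

/-! ### The differential on words -/

theorem contractNth_letters {n s : ℕ} (f : Cochain n s) (i : Fin s) (u : Word n (s + 1)) {c : ℂ}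
    (h : mono n (u i.castSucc) * mono n (u i.succ) = c • mono n (u i.castSucc ∪ u i.succ)) :
    f (Fin.contractNth i.castSucc (· * ·) (letters u)) = c • f (letters (merge i u)) := by
  have : Fin.contractNth i.castSucc (· * ·) (letters u) =
      Function.update (letters (merge i u)) i (c • letters (merge i u) i) := by
    ext1 j
    rcases lt_trichotomy j i with hj | rfl | hj
    · rw [Function.update_of_ne hj.ne, Fin.contractNth_apply_of_lt _ _ _ _ hj, letters, letters,
        merge_of_lt u hj]
    · rw [Function.update_self, Fin.contractNth_apply_of_eq _ _ _ _ rfl]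
      simp only [letters, merge_self]
      exact h
    · rw [Function.update_of_ne hj.ne', Fin.contractNth_apply_of_gt _ _ _ _ hj, letters, letters,
        merge_of_gt u hj]
  rw [this, MultilinearMap.map_update_smul, Function.update_eq_self]

theorem innerTerm_letters_of_not_disjoint {n s : ℕ} (f : Cochain n s) (i : Fin s)
    (u : Word n (s + 1)) (h : ¬Disjoint (u i.castSucc) (u i.succ)) :
    innerTerm i f (letters u) = 0 := by
  rw [innerTerm_apply, contractNth_letters f i u (c := 0), zero_smul]
  rw [zero_smul, mono_mul_of_not_disjoint h]

theorem exists_innerTerm_letters {n s : ℕ} (f : Cochain n s) (i : Fin s)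
    (u : Word n (s + 1)) (h : Disjoint (u i.castSucc) (u i.succ)) :
    ∃ c : ℂ, c ≠ 0 ∧ innerTerm i f (letters u) = c • f (letters (merge i u)) := by
  obtain ⟨c, hc, hm⟩ := exists_mono_mul_of_disjoint h
  exact ⟨c, hc, contractNth_letters f i u hm⟩

theorem innerTerm_letters_of_eq_empty {n s : ℕ} (f : Cochain n s) (i : Fin s)
    (u : Word n (s + 1)) (h : u i.castSucc = ∅ ∨ u i.succ = ∅) :
    innerTerm i f (letters u) = f (letters (merge i u)) := by
  rw [innerTerm_apply, contractNth_letters f i u (c := 1), one_smul]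
  rcases h with h | h <;> simp [h, mono_empty]

theorem innerTerm_letters_eq_zero {n s : ℕ} (f : Cochain n s) (i : Fin s) (u : Word n (s + 1))
    (h : Disjoint (u i.castSucc) (u i.succ) → f (letters (merge i u)) = 0) :
    innerTerm i f (letters u) = 0 := by
  by_cases hd : Disjoint (u i.castSucc) (u i.succ)
  · obtain ⟨c, -, hc⟩ := exists_innerTerm_letters f i u hd
    rw [hc, h hd, smul_zero]
  · exact innerTerm_letters_of_not_disjoint f i u hd

theorem conjParity_letters {n s : ℕ} (f : Cochain n s) (w : Word n s) :
    conjParity f (letters w) = (∏ j, (-1 : ℂ) ^ (w j).card) • parity n (f (letters w)) := by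
  simp only [conjParity_apply, letters, parity_mono]
  rw [MultilinearMap.map_smul_univ, map_smul]
  rfl

theorem tail_letters {n s : ℕ} (u : Word n (s + 1)) :
    Fin.tail (letters u) = letters (Fin.tail u) := rfl

theorem init_letters {n s : ℕ} (u : Word n (s + 1)) :
    Fin.init (letters u) = letters (Fin.init u) := rfl

theorem leftTerm_letters_eq_zero {n s : ℕ} (f : Cochain n s) (u : Word n (s + 1))
    (h : f (letters (Fin.tail u)) = 0) : leftTerm f (letters u) = 0 := by
  rw [leftTerm_apply, tail_letters, conjParity_letters, h]
  simp

theorem leftTerm_letters_of_eq_empty {n s : ℕ} (f : Cochain n s) (u : Word n (s + 1))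
    (h : u 0 = ∅) : leftTerm f (letters u) = f (letters (Fin.tail u)) := by
  rw [leftTerm_apply, tail_letters]
  have : letters u 0 = 1 := by rw [letters, h, mono_empty]
  rw [this, evenPart_apply, oddPart_apply, map_one, sub_self, smul_zero, zero_mul, add_zero,
    ← two_smul ℂ (1 : A n), smul_smul]
  norm_num

theorem evenPart_mono {n : ℕ} (J : Finset (Fin (n + 2))) :
    ∃ c : ℂ, evenPart n (mono n J) = c • mono n J := by
  refine ⟨1 / 2 * (1 + (-1) ^ J.card), ?_⟩
  rw [evenPart_apply, parity_mono, mul_smul, add_smul, one_smul]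

theorem oddPart_mono {n : ℕ} (J : Finset (Fin (n + 2))) :
    ∃ c : ℂ, oddPart n (mono n J) = c • mono n J := by
  refine ⟨1 / 2 * (1 - (-1) ^ J.card), ?_⟩
  rw [oddPart_apply, parity_mono, mul_smul, sub_smul, one_smul]

theorem indicator_add_weight_tail {n s : ℕ} (u : Word n (s + 1)) :
    indicator (u 0) + weight (Fin.tail u) = weight u := by
  ext i
  simp only [Pi.add_apply, weight, Fin.sum_univ_succ (n := s), indicator]
  rfl

theorem indicator_add_weight_init {n s : ℕ} (u : Word n (s + 1)) :
    indicator (u (Fin.last s)) + weight (Fin.init u) = weight u := by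
  ext i
  rw [add_comm]
  simp only [Pi.add_apply, weight, Fin.sum_univ_castSucc (n := s), indicator]
  rfl

/-- The Hochschild differential preserves equivariant cochains of degree `t`. -/
theorem hochDiff_mem_cochains {n s : ℕ} {t : ℚ} {f : Cochain n s} (hf : f ∈ cochains n s t) :
    hochDiff n s f ∈ cochains n (s + 1) t := by
  rw [mem_cochains_iff] at hf
  have hleft : leftTerm f ∈ cochains n (s + 1) t := by
    rw [mem_cochains_iff]
    intro u
    obtain ⟨c, hc⟩ := evenPart_mono (u 0)
    obtain ⟨d, hd⟩ := oddPart_mono (u 0)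
    rw [leftTerm_apply, tail_letters, conjParity_letters, letters, hc, hd, smul_mul_assoc,
      smul_mul_assoc, mul_smul_comm, ← indicator_add_weight_tail]
    exact add_mem (Submodule.smul_mem _ _ (mono_mul_mem_valueSpace _ (hf _)))
      (Submodule.smul_mem _ _ (Submodule.smul_mem _ _
        (mono_mul_mem_valueSpace _ (parity_mem_valueSpace (hf _)))))
  have hinner : ∀ i, innerTerm i f ∈ cochains n (s + 1) t := by
    intro i
    rw [mem_cochains_iff]
    intro u
    by_cases hd : Disjoint (u i.castSucc) (u i.succ)
    · obtain ⟨c, -, hc⟩ := exists_innerTerm_letters f i u hd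
      rw [hc, ← weight_merge i u hd]
      exact Submodule.smul_mem _ _ (hf _)
    · rw [innerTerm_letters_of_not_disjoint f i u hd]
      exact zero_mem _
  have hright : rightTerm f ∈ cochains n (s + 1) t := by
    rw [mem_cochains_iff]
    intro u
    rw [rightTerm_apply, init_letters, ← indicator_add_weight_init]
    exact mul_mono_mem_valueSpace _ (hf _)
  exact add_mem (add_mem hleft (sum_mem fun i _ => Submodule.smul_mem _ _ (hinner i)))
    (Submodule.smul_mem _ _ hright)

/-! ### Vanishing of cochains -/

/-- If a cochain vanishes on upper words and on all words of lower complexity, and its differential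
vanishes on a word with an ascent, then it vanishes on the word matched with the latter. -/
theorem eq_zero_of_isAscentAt {n s : ℕ} {f : Cochain n s} {k : Fin s} {u : Word n (s + 1)}
    (hu : IsAscentAt k u) (hupper : ∀ w, IsUpper w → f (letters w) = 0)
    (hδ : hochDiff n s f (letters u) = 0)
    (ih : ∀ w : Word n s, complexity w < complexity (merge k u) → f (letters w) = 0) :
    f (letters (merge k u)) = 0 := by
  have hcu : complexity (merge k u) = complexity u := by
    rw [← complexity_merge k u hu.disjoint,
      inv_eq_zero_iff.2 fun x hx y hy => (hu.lt x hx y hy).le, add_zero]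
  rw [hcu] at ih
  have hleft : leftTerm f (letters u) = 0 := by
    refine leftTerm_letters_eq_zero f u (ih _ ?_)
    have h1 := complexity_tail u
    have h2 := (hu.nonempty 0).card_pos
    omega
  have hright : rightTerm f (letters u) = 0 := by
    rw [rightTerm_apply, init_letters, ih _ ?_, zero_mul]
    have h1 := complexity_init u
    have h2 := (hu.nonempty (Fin.last s)).card_pos
    omega
  have hinv : ∀ i, 0 < inv (u i.castSucc) (u i.succ) → innerTerm i f (letters u) = 0 := by
    intro i hi
    refine innerTerm_letters_eq_zero f i u fun hd => ih _ ?_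
    have := complexity_merge i u hd
    omega
  have hinner : ∀ i, i ≠ k → innerTerm i f (letters u) = 0 := by
    intro i hik
    rcases lt_or_gt_of_ne hik with hlt | hgt
    · -- two letters of the decreasing prefix: equal, or an inversion is removed
      by_cases hd : Disjoint (u i.castSucc) (u i.succ)
      · apply hinv
        rw [Nat.pos_iff_ne_zero, Ne, inv_eq_zero_iff]
        intro hle
        obtain ⟨x, hx⟩ := hu.nonempty i.castSucc
        obtain ⟨y, hy⟩ := hu.nonempty i.succ
        have hxy : x = y := le_antisymm (hle x hx y hy) (hu.le i hlt x hx y hy)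
        exact Finset.disjoint_left.1 hd hx (hxy ▸ hy)
      · exact innerTerm_letters_of_not_disjoint f i u hd
    · -- to the right of the ascent: the ascent survives, or an inversion is removed
      by_cases hi0 : inv (u i.castSucc) (u i.succ) = 0
      swap
      · exact hinv i (Nat.pos_of_ne_zero hi0)
      refine innerTerm_letters_eq_zero f i u fun _ => hupper _ ?_
      obtain ⟨s, rfl⟩ : ∃ s', s = s' + 1 := ⟨s - 1, by omega⟩
      have hks : k.val < s := by
        have := Fin.lt_def.1 hgt
        omega
      have hck : (⟨k.val, hks⟩ : Fin s).castSucc = k := rfl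
      refine ⟨⟨k.val, hks⟩, Or.inl ⟨merge_nonempty hu.nonempty i, ?_, ?_, ?_⟩⟩
      · intro j hj
        rw [merge_of_lt u (lt_of_le_of_lt hj hgt)]
        exact hu.card_eq_one _ hj
      · intro j hj
        have hjk : j.castSucc < k := hj
        have hjk' : j.succ ≤ k := hj
        rw [merge_of_lt u (hjk.trans hgt), merge_of_lt u (hjk'.trans_lt hgt)]
        exact hu.le _ hjk
      · rw [hck, merge_of_lt u hgt]
        intro x hx y hy
        have hle : (⟨k.val, hks⟩ : Fin s).succ ≤ i := hgt
        rcases hle.eq_or_lt with h | h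
        · rw [h, merge_self, Finset.mem_union] at hy
          have hi : i.castSucc = k.succ := by
            rw [← h]
            rfl
          rcases hy with hy | hy
          · exact hu.lt x hx y (hi ▸ hy)
          · obtain ⟨z, hz⟩ := hu.nonempty i.castSucc
            exact (hu.lt x hx z (hi ▸ hz)).trans_le (inv_eq_zero_iff.1 hi0 z hz y hy)
        · rw [merge_of_lt u h] at hy
          exact hu.lt x hx y hy
  have hsum : hochDiff n s f (letters u) = leftTerm f (letters u) +
      ∑ i : Fin s, (-1 : ℂ) ^ (i.val + 1) • innerTerm i f (letters u) +
      (-1 : ℂ) ^ (s + 1) • rightTerm f (letters u) := by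
    simp [hochDiff]
  rw [hδ, hleft, hright, smul_zero, zero_add, add_zero,
    Finset.sum_eq_single k (fun i _ hi => by rw [hinner i hi, smul_zero]) (by simp)] at hsum
  obtain ⟨c, hc, hck⟩ := exists_innerTerm_letters f k u hu.disjoint
  rw [hck, smul_smul] at hsum
  exact (smul_eq_zero.1 hsum.symm).resolve_left (mul_ne_zero (pow_ne_zero _ (by norm_num)) hc)

/-- Merging at any position that meets the run of empty letters gives the same word. -/
theorem IsUnitRun.merge_eq {n s r : ℕ} {k i : Fin s} {u : Word n (s + 1)} (h : IsUnitRun k r u)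
    (hr : 1 < r) (hik : k.val ≤ i.val + 1) (hi : i.val < k.val + r) : merge i u = merge k u := by
  ext1 j
  have hrun := h.run
  rw [merge_apply, merge_apply]
  simp only [Fin.lt_def, Fin.ext_iff]
  have e1 : k.val ≤ j.val → j.val < k.val + r → u j.castSucc = ∅ := fun h1 h2 =>
    h.run _ (by simpa using h1) (by simpa using h2)
  have e2 : k.val ≤ j.val + 1 → j.val + 1 < k.val + r → u j.succ = ∅ := fun h1 h2 =>
    h.run _ (by simpa using h1) (by simpa using h2)
  split_ifs with h1 h2 h3 h4 h5 h6 h7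
  · rfl
  · rw [e1 (by omega) (by omega), e2 (by omega) (by omega), Finset.empty_union]
  · rw [e1 (by omega) (by omega), e2 (by omega) (by omega)]
  · rw [e2 (by omega) (by omega), Finset.union_empty]
  · rfl
  · rw [e1 (by omega) (by omega), Finset.empty_union]
  · omega
  · rw [e1 (by omega) (by omega), Finset.empty_union]
  · rfl

theorem sum_neg_one_pow_Icc {k r : ℕ} (hr : Even r) :
    ∑ i ∈ Finset.Icc k (k + r), (-1 : ℂ) ^ i = (-1) ^ k := by
  obtain ⟨a, rfl⟩ := hr
  induction a with
  | zero => simp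
  | succ a ih =>
    rw [show k + (a + 1 + (a + 1)) = k + (a + a) + 1 + 1 by ring,
      Finset.sum_Icc_succ_top (by omega), Finset.sum_Icc_succ_top (by omega), ih, pow_succ]
    ring

/-- The analogue of `eq_zero_of_isAscentAt` for words with an empty letter. The `r + 1` terms of the
differential that meet the run of empty letters agree up to alternating signs, and `r` is even. -/
theorem eq_zero_of_isUnitRun {n s r : ℕ} {f : Cochain n s} {k : Fin s} {u : Word n (s + 1)}
    (hu : IsUnitRun k r u) (hr : Even r) (hupper : ∀ w, IsUpper w → f (letters w) = 0)
    (hδ : hochDiff n s f (letters u) = 0)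
    (ih : ∀ w : Word n s, complexity w < complexity (merge k u) → f (letters w) = 0) :
    f (letters (merge k u)) = 0 := by
  have hr2 := hu.one_lt hr
  have hle := hu.le
  have h0 : u k.castSucc = ∅ := hu.run _ (by simp) (by simp; omega)
  have hcu : complexity (merge k u) = complexity u := by
    rw [← complexity_merge k u (by simp [h0]), h0, inv_eq_zero_iff.2 (by simp), add_zero]
  rw [hcu] at ih
  have hface : ∀ i ∈ Finset.range (s + 2), face i f (letters u) =
      if i ∈ Finset.Icc k.val (k.val + r) then f (letters (merge k u)) else 0 := by
    intro i hi
    rw [Finset.mem_range] at hi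
    simp only [Finset.mem_Icc]
    rcases i with - | i
    · rw [face_zero]
      split_ifs with hik
      · have hk0 : k.val = 0 := by omega
        rw [leftTerm_letters_of_eq_empty f u (hu.run _ (by simp; omega) (by simp; omega))]
        congr 2
        ext1 j
        rw [merge_apply]
        simp only [Fin.lt_def, Fin.ext_iff, Fin.tail]
        rw [if_neg (by omega)]
        split_ifs with hj
        · rw [hu.run j.castSucc (by simp; omega) (by simp; omega), Finset.empty_union]
        · rfl
      · refine leftTerm_letters_eq_zero f u (ih _ ?_)
        have h1 := complexity_tail u
        have h2 := (hu.before 0 (by simp; omega)).card_pos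
        omega
    · by_cases his : i < s
      · rw [face_succ his]
        split_ifs with hik
        · rw [innerTerm_letters_of_eq_empty, hu.merge_eq hr2 hik.1 (by simp only; omega)]
          by_cases hki : k.val ≤ i
          · exact Or.inl (hu.run _ (by simpa using hki) (by simp; omega))
          · exact Or.inr (hu.run _ (by simp; omega) (by simp; omega))
        · refine innerTerm_letters_eq_zero f _ u fun _ => hupper _ ?_
          obtain ⟨s, rfl⟩ : ∃ s', s = s' + 1 := ⟨s - 1, by omega⟩
          rcases lt_or_ge (i + 1) k.val with hlt | hge
          · refine ⟨⟨k.val - 1, by omega⟩, Or.inr ⟨r, hr, by omega, by simp only; omega, ?_, ?_, ?_⟩⟩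
            · intro j hj
              simp only at hj
              rw [merge_apply]
              split_ifs
              · exact hu.before _ (by simp; omega)
              · exact (hu.before _ (by simp; omega)).mono Finset.subset_union_left
              · exact hu.before _ (by simp; omega)
            · intro j hj1 hj2
              simp only at hj1 hj2
              rw [merge_of_gt u (by rw [Fin.lt_def]; simp only; omega)]
              exact hu.run _ (by simp; omega) (by simp; omega)
            · intro j hj
              simp only at hj
              rw [merge_of_gt u (by rw [Fin.lt_def]; simp only; omega)]
              exact hu.after _ (by simp; omega)
          · have hge' : k.val + r ≤ i := by omega
            refine ⟨⟨k.val, by omega⟩, Or.inr ⟨r, hr, by omega, by simp only; omega, ?_, ?_, ?_⟩⟩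
            · intro j hj
              simp only at hj
              rw [merge_of_lt u (by rw [Fin.lt_def]; simp only; omega)]
              exact hu.before _ (by simp; omega)
            · intro j hj1 hj2
              simp only at hj1 hj2
              rw [merge_of_lt u (by rw [Fin.lt_def]; simp only; omega)]
              exact hu.run _ (by simp; omega) (by simp; omega)
            · intro j hj
              simp only at hj
              rw [merge_apply]
              split_ifs with h1 h2
              · exact hu.after _ (by simp; omega)
              · exact (hu.after _ (by simp; omega)).mono Finset.subset_union_left
              · simp only [Fin.lt_def, Fin.ext_iff] at h1 h2
                omega
      · obtain rfl : i = s := by omega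
        rw [face_last, rightTerm_apply, init_letters]
        split_ifs with hik
        · have hlast : u (Fin.last i) = ∅ :=
            hu.run _ (by rw [Fin.val_last]; omega) (by rw [Fin.val_last]; omega)
          rw [letters, hlast, mono_empty, mul_one]
          congr 2
          ext1 j
          rw [merge_apply]
          simp only [Fin.lt_def, Fin.ext_iff, Fin.init]
          split_ifs with h1 h2
          · rfl
          · rw [hu.run j.succ (by simp; omega) (by simp; omega), Finset.union_empty]
          · rw [hu.run j.succ (by simp; omega) (by simp; omega),
              hu.run j.castSucc (by simp; omega) (by simp; omega)]
        · by_cases hki : k.val + r = i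
          · rw [ih _ ?_, zero_mul]
            have h1 := complexity_init u
            have h2 := (hu.after (Fin.last i) (by simp; omega)).card_pos
            omega
          · rw [hupper _ ?_, zero_mul]
            obtain ⟨i, rfl⟩ : ∃ i', i = i' + 1 := ⟨i - 1, by omega⟩
            exact ⟨⟨k.val, by omega⟩, Or.inr ⟨r, hr, by omega, by simp only; omega,
              fun j hj => hu.before _ hj, fun j hj1 hj2 => hu.run _ hj1 hj2,
              fun j hj => hu.after _ hj⟩⟩
  rw [hochDiff_eq_sum_face, sum_apply] at hδ
  simp only [smul_apply] at hδ
  rw [Finset.sum_congr rfl fun i hi => by rw [hface i hi, smul_ite, smul_zero],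
    Finset.sum_ite_mem] at hδ
  have hsub : Finset.range (s + 2) ∩ Finset.Icc k.val (k.val + r) =
      Finset.Icc k.val (k.val + r) := by
    rw [Finset.inter_eq_right]
    intro i hi
    rw [Finset.mem_Icc] at hi
    rw [Finset.mem_range]
    omega
  rw [hsub, ← Finset.sum_smul, sum_neg_one_pow_Icc hr] at hδ
  exact (smul_eq_zero.1 hδ).resolve_left (pow_ne_zero _ (by norm_num))

/-- A cochain which vanishes on upper and critical words, and whose differential vanishes on upper
words, is zero. -/
theorem eq_zero_of_forall_isUpper {n s : ℕ} {f : Cochain n s}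
    (hupper : ∀ w, IsUpper w → f (letters w) = 0)
    (hcrit : ∀ w, IsCritical w → f (letters w) = 0)
    (hδ : ∀ u, IsUpper u → hochDiff n s f (letters u) = 0) : f = 0 := by
  have key : ∀ (N : ℕ) (w : Word n s), complexity w < N → f (letters w) = 0 := by
    intro N
    induction N with
    | zero => intro w hw; omega
    | succ N ih =>
      intro w hw
      rcases isUpper_or_isCritical_or_exists w with h | h | ⟨u, k, h, rfl⟩
      · exact hupper w h
      · exact hcrit w h
      · have hu := hδ u ⟨k, h⟩
        rcases h with h | ⟨r, hr, h⟩
        · exact eq_zero_of_isAscentAt h hupper hu fun w' hw' => ih w' (by omega)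
        · exact eq_zero_of_isUnitRun h hr hupper hu fun w' hw' => ih w' (by omega)
  exact cochain_ext fun w => key _ w (Nat.lt_succ_self _)

/-! ### Existence of cochains with prescribed values -/

theorem weight_merge_of_isUpperAt {n s : ℕ} {k : Fin s} {u : Word n (s + 1)} (h : IsUpperAt k u) :
    weight (merge k u) = weight u := by
  refine weight_merge k u ?_
  rcases h with h | ⟨r, hr, h⟩
  · exact h.disjoint
  · have hpos := h.pos
    rw [h.run k.castSucc (by simp) (by simp; omega)]
    exact Finset.disjoint_empty_left _

/-- An equivariant cochain of degree `t` can be prescribed on upper and critical words, and its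
differential on upper words. The solution is unique, so that its existence follows by counting
dimensions. -/
theorem exists_cochain_of_isUpper {n s : ℕ} {t : ℚ} (F : Word n s → A n)
    (hF : ∀ w, F w ∈ valueSpace t (weight w)) (G : Word n (s + 1) → A n)
    (hG : ∀ u, G u ∈ valueSpace t (weight u)) :
    ∃ f ∈ cochains n s t, (∀ w, IsUpper w ∨ IsCritical w → f (letters w) = F w) ∧
      ∀ u, IsUpper u → hochDiff n s f (letters u) = G u := by
  classical
  -- `P` holds for the lower words; `T` records the values of `f` on the other words, and on a lower
  -- word the value of `δ f` on the upper word matched with it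
  let P : Word n s → Prop := fun w => ∃ (u : Word n (s + 1)) (k : Fin s),
    IsUpperAt k u ∧ merge k u = w
  let T : Cochain n s →ₗ[ℂ] Word n s → A n := LinearMap.pi fun w =>
    if h : P w then
      { toFun := fun f => hochDiff n s f (letters h.choose)
        map_add' := fun f g => by rw [map_add, add_apply]
        map_smul' := fun c f => by rw [map_smul, smul_apply, RingHom.id_apply] }
    else
      { toFun := fun f => f (letters w)
        map_add' := fun f g => rfl
        map_smul' := fun c f => rfl }
  have hT1 : ∀ f u k, IsUpperAt k u → T f (merge k u) = hochDiff n s f (letters u) := by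
    intro f u k hu
    have h : P (merge k u) := ⟨u, k, hu, rfl⟩
    simp only [T, LinearMap.pi_apply, dif_pos h, LinearMap.coe_mk, AddHom.coe_mk]
    obtain ⟨k', hk', he⟩ := h.choose_spec
    rw [eq_of_merge_eq hk' hu he]
  have hT2 : ∀ f w, IsUpper w ∨ IsCritical w → T f w = f (letters w) := by
    intro f w hw
    have h : ¬P w := by
      rintro ⟨u, k, hu, rfl⟩
      exact hw.elim (not_isUpper_merge hu) (not_isCritical_merge hu)
    simp only [T, LinearMap.pi_apply, dif_neg h, LinearMap.coe_mk, AddHom.coe_mk]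
  have hmem : ∀ f ∈ cochains n s t, ∀ w, T f w ∈ valueSpace t (weight w) := by
    intro f hf w
    rcases isUpper_or_isCritical_or_exists w with h | h | ⟨u, k, h, rfl⟩
    · rw [hT2 f w (Or.inl h)]
      exact mem_cochains_iff.1 hf w
    · rw [hT2 f w (Or.inr h)]
      exact mem_cochains_iff.1 hf w
    · rw [hT1 f u k h, weight_merge_of_isUpperAt h]
      exact mem_cochains_iff.1 (hochDiff_mem_cochains hf) u
  -- `E` restricts cochains to words, so that `T` becomes an endomorphism of `cochains n s t`
  let E : Cochain n s →ₗ[ℂ] Word n s → A n :=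
    { toFun := fun f w => f (letters w)
      map_add' := fun f g => rfl
      map_smul' := fun c f => rfl }
  let e : Cochain n s ≃ₗ[ℂ] (Word n s → A n) := LinearEquiv.ofBijective E
    ⟨fun f g h => cochain_ext fun w => congrFun h w,
      fun F => (exists_cochain F).imp fun f hf => funext hf⟩
  have he : ∀ F w, e.symm F (letters w) = F w := fun F w => congrFun (e.apply_symm_apply F) w
  have hres : ∀ f ∈ cochains n s t, (e.symm.toLinearMap ∘ₗ T) f ∈ cochains n s t := by
    intro f hf
    rw [mem_cochains_iff]
    intro w
    rw [LinearMap.comp_apply, LinearEquiv.coe_coe, he]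
    exact hmem f hf w
  have : Module.Finite ℂ (A n) := Module.Finite.of_basis (mono n)
  have : Module.Finite ℂ (Cochain n s) := Module.Finite.equiv e.symm
  let R : cochains n s t →ₗ[ℂ] cochains n s t := (e.symm.toLinearMap ∘ₗ T).restrict hres
  have hRT : ∀ f : cochains n s t, ∀ w, (R f : Cochain n s) (letters w) = T f w :=
    fun f w => he _ _
  have hinj : Function.Injective R := by
    rw [injective_iff_map_eq_zero]
    intro f hf
    have hz : ∀ w, T (f : Cochain n s) w = 0 := fun w => by
      rw [← hRT, hf]
      rfl
    refine Subtype.ext (eq_zero_of_forall_isUpper (fun w hw => ?_) (fun w hw => ?_) ?_)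
    · rw [← hT2 _ w (Or.inl hw), hz]
    · rw [← hT2 _ w (Or.inr hw), hz]
    · intro u hu
      cases s with
      | zero => obtain ⟨k, -⟩ := hu; exact k.elim0
      | succ s =>
        obtain ⟨k, hk⟩ := hu
        rw [← hT1 _ u k hk, hz]
  have hsurj : Function.Surjective R := LinearMap.injective_iff_surjective.1 hinj
  let H : Word n s → A n := fun w => if h : P w then G h.choose else F w
  have hH : e.symm H ∈ cochains n s t := by
    rw [mem_cochains_iff]
    intro w
    rw [he]
    by_cases h : P w
    · simp only [H, dif_pos h]
      obtain ⟨k, hk, hw⟩ := h.choose_spec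
      have := hG h.choose
      rwa [← weight_merge_of_isUpperAt hk, hw] at this
    · simp only [H, dif_neg h]
      exact hF w
  obtain ⟨f, hf⟩ := hsurj ⟨e.symm H, hH⟩
  have hTH : ∀ w, T (f : Cochain n s) w = H w := fun w => by
    rw [← hRT, hf]
    exact he H w
  refine ⟨f, f.2, fun w hw => ?_, fun u hu => ?_⟩
  · have h : ¬P w := by
      rintro ⟨u, k, hu, rfl⟩
      exact hw.elim (not_isUpper_merge hu) (not_isCritical_merge hu)
    rw [← hT2 _ w hw, hTH]
    exact dif_neg h
  · cases s with
    | zero => obtain ⟨k, -⟩ := hu; exact k.elim0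
    | succ s =>
      obtain ⟨k, hk⟩ := hu
      have h : P (merge k u) := ⟨u, k, hk, rfl⟩
      rw [← hT1 _ u k hk, hTH]
      simp only [H, dif_pos h]
      obtain ⟨k', hk', hw⟩ := h.choose_spec
      rw [eq_of_merge_eq hk' hk hw]

/-! ### Coefficients of polyvector fields -/

/-- The coefficient in `A` of the monomial `z^m`. -/
def coeffAt {n : ℕ} (m : Fin (n + 2) →₀ ℕ) : PolyVec n →ₗ[ℂ] A n :=
  Finsupp.lapply m ∘ₗ (TensorProduct.equivFinsuppOfBasisLeft
    (MvPolynomial.basisMonomials (Fin (n + 2)) ℂ)).toLinearMap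

theorem coeffAt_tmul {n : ℕ} (m : Fin (n + 2) →₀ ℕ) (p : MvPolynomial (Fin (n + 2)) ℂ) (x : A n) :
    coeffAt m (p ⊗ₜ x) = p.coeff m • x :=
  TensorProduct.equivFinsuppOfBasisLeft_apply_tmul_apply _ p x m

theorem polyVec_ext {n : ℕ} {p q : PolyVec n} (h : ∀ m, coeffAt m p = coeffAt m q) : p = q :=
  (TensorProduct.equivFinsuppOfBasisLeft
    (MvPolynomial.basisMonomials (Fin (n + 2)) ℂ)).injective (Finsupp.ext h)

theorem exists_eq_sum_coeffAt {n : ℕ} (p : PolyVec n) : ∃ S : Finset (Fin (n + 2) →₀ ℕ),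
    (∀ m ∈ S, coeffAt m p ≠ 0) ∧
    p = ∑ m ∈ S, (MvPolynomial.monomial m (1 : ℂ)) ⊗ₜ[ℂ] coeffAt m p := by
  let e := TensorProduct.equivFinsuppOfBasisLeft (N := A n)
    (MvPolynomial.basisMonomials (Fin (n + 2)) ℂ)
  refine ⟨(e p).support, fun m hm => Finsupp.mem_support_iff.1 hm, ?_⟩
  have := e.symm_apply_apply p
  rw [TensorProduct.equivFinsuppOfBasisLeft_symm_apply] at this
  rw [MvPolynomial.coe_basisMonomials] at this
  exact this.symm

theorem coeff_aeval_C_mul_X {σ : Type*} (c : σ → ℂ) (p : MvPolynomial σ ℂ) (m : σ →₀ ℕ) :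
    (MvPolynomial.aeval (fun i => MvPolynomial.C (c i) * MvPolynomial.X i) p).coeff m =
      (m.prod fun i k => c i ^ k) * p.coeff m := by
  classical
  induction p using MvPolynomial.induction_on' with
  | monomial k a =>
    rw [MvPolynomial.aeval_monomial]
    simp only [mul_pow, Finsupp.prod_mul, ← map_pow]
    rw [MvPolynomial.algebraMap_eq, ← map_finsuppProd, ← mul_assoc, ← map_mul,
      MvPolynomial.coeff_C_mul]
    have : (k.prod fun i e => (MvPolynomial.X i : MvPolynomial σ ℂ) ^ e) =
        MvPolynomial.monomial k 1 := by
      rw [MvPolynomial.monomial_eq]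
      simp
    rw [this, MvPolynomial.coeff_monomial, MvPolynomial.coeff_monomial]
    split_ifs with h
    · subst h
      ring
    · simp
  | add p q hp hq => rw [map_add, MvPolynomial.coeff_add, hp, hq, MvPolynomial.coeff_add, mul_add]

theorem coeffAt_polyVecAct {n : ℕ} (α : Torus n) (m : Fin (n + 2) →₀ ℕ) (p : PolyVec n) :
    coeffAt m (polyVecAct α p) =
      (∏ i, ((α (eM n i) : ℂˣ) : ℂ) ^ m i)⁻¹ • torusAct α (coeffAt m p) := by
  induction p using TensorProduct.induction_on with
  | zero => simp
  | tmul q x =>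
    rw [polyVecAct, TensorProduct.map_tmul, coeffAt_tmul, coeffAt_tmul, map_smul, smul_smul,
      AlgHom.toLinearMap_apply, coeff_aeval_C_mul_X, AlgHom.toLinearMap_apply,
      Finsupp.prod_fintype _ _ (by simp), ← Finset.prod_inv_distrib]
    simp
  | add p q hp hq => simp only [map_add, hp, hq, smul_add]

theorem torus_prod_ne_zero {n : ℕ} (α : Torus n) (m : Fin (n + 2) → ℕ) :
    ∏ i, ((α (eM n i) : ℂˣ) : ℂ) ^ m i ≠ 0 :=
  Finset.prod_ne_zero_iff.2 fun _ _ => pow_ne_zero _ (Units.ne_zero _)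

theorem mem_invariants_iff {n : ℕ} {p : PolyVec n} : p ∈ invariants n ↔
    ∀ (α : Torus n) m,
      torusAct α (coeffAt m p) = (∏ i, ((α (eM n i) : ℂˣ) : ℂ) ^ m i) • coeffAt m p := by
  simp only [invariants, Submodule.mem_iInf, LinearMap.mem_eqLocus, LinearMap.id_apply]
  refine forall_congr' fun α => ?_
  constructor
  · intro h m
    have := coeffAt_polyVecAct α m p
    rw [h] at this
    exact ((eq_inv_smul_iff₀ (torus_prod_ne_zero α m)).1 this).symm
  · intro h
    refine polyVec_ext fun m => ?_
    rw [coeffAt_polyVecAct, h, smul_smul, inv_mul_cancel₀ (torus_prod_ne_zero α m), one_smul]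

theorem coeffAt_of_mem_symExt {n s j : ℕ} {p : PolyVec n} (hp : p ∈ symExt n s j)
    (m : Fin (n + 2) →₀ ℕ) :
    coeffAt m p ∈ ⋀[ℂ]^j (V n) ∧ (∑ i, m i ≠ s → coeffAt m p = 0) := by
  obtain ⟨q, rfl⟩ := hp
  induction q using TensorProduct.induction_on with
  | zero => simp
  | tmul q x =>
    rw [TensorProduct.map_tmul, coeffAt_tmul]
    refine ⟨Submodule.smul_mem _ _ x.2, fun hm => ?_⟩
    have h := q.2
    rw [MvPolynomial.mem_homogeneousSubmodule] at h
    rw [Submodule.subtype_apply, h.coeff_eq_zero (by rwa [Finsupp.degree_eq_sum]), zero_smul]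
  | add p q hp hq =>
    rw [map_add, map_add]
    refine ⟨add_mem hp.1 hq.1, fun hm => ?_⟩
    rw [hp.2 hm, hq.2 hm, add_zero]

/-- The numerical condition in the definition of `hkrTarget` says that the degree of `Λ^j` is `t`
more than that of a product of `s` generators. -/
theorem degree_condition_iff {n s j : ℕ} {t : ℚ} :
    (2 : ℚ) / (n + 2) * s + (n : ℚ) / (n + 2) * j = s + t ↔
      (n : ℚ) / (n + 2) * j = t + (n : ℚ) / (n + 2) * s := by
  have hn : (n : ℚ) + 2 ≠ 0 := by positivity
  field_simp
  constructor <;> intro h <;> linear_combination h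

/-- An element of `Sym ⊗ Λ` lies in the target of the Hochschild-Kostant-Rosenberg map if and only
if it is homogeneous of degree `s` in the `z_i` and all its coefficients lie in the space of values
of equivariant cochains of degree `t`. -/
theorem mem_hkrTarget_iff {n s : ℕ} {t : ℚ} {p : PolyVec n} : p ∈ hkrTarget n s t ↔
    ∀ m : Fin (n + 2) →₀ ℕ, coeffAt m p ∈ valueSpace t m ∧ (∑ i, m i ≠ s → coeffAt m p = 0) := by
  constructor
  · intro hp m
    let S : Submodule ℂ (PolyVec n) :=
      { carrier := {p | coeffAt m p ∈ valueSpace t m ∧ (∑ i, m i ≠ s → coeffAt m p = 0)}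
        add_mem' := fun {p q} hp hq => by
          refine ⟨by rw [map_add]; exact add_mem hp.1 hq.1, fun hm => ?_⟩
          rw [map_add, hp.2 hm, hq.2 hm, add_zero]
        zero_mem' := by simp
        smul_mem' := fun c p hp => by
          refine ⟨by rw [map_smul]; exact Submodule.smul_mem _ _ hp.1, fun hm => ?_⟩
          rw [map_smul, hp.2 hm, smul_zero] }
    have hS : hkrTarget n s t ≤ S := by
      refine iSup₂_le fun j hj p hp => ?_
      obtain ⟨h1, h2⟩ := hp
      obtain ⟨h3, h4⟩ := coeffAt_of_mem_symExt h1 m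
      refine ⟨?_, h4⟩
      by_cases hm : ∑ i, m i = s
      · rw [mem_valueSpace_iff]
        refine ⟨?_, fun α => mem_invariants_iff.1 h2 α m⟩
        rw [degree_condition_iff] at hj
        rw [hm, ← hj]
        exact Submodule.mem_iSup_of_mem j (Submodule.mem_iSup_of_mem rfl h3)
      · rw [h4 hm]
        exact zero_mem _
    exact hS hp
  · intro hp
    obtain ⟨S, hS, hpS⟩ := exists_eq_sum_coeffAt p
    rw [hpS]
    refine Submodule.sum_mem _ fun m hm => ?_
    have hms : ∑ i, m i = s := by
      by_contra h
      exact hS m hm ((hp m).2 h)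
    have key : valueSpace t m ≤ (hkrTarget n s t).comap
        (TensorProduct.mk ℂ _ (A n) (MvPolynomial.monomial m (1 : ℂ))) := by
      rw [valueSpace, Submodule.span_le]
      rintro _ ⟨K, hK, rfl⟩
      refine Submodule.mem_iSup_of_mem K.card (Submodule.mem_iSup_of_mem ?_ ⟨?_, ?_⟩)
      · rw [degree_condition_iff, ← hms]
        exact hK.1
      · have h1 : (MvPolynomial.monomial m (1 : ℂ)) ∈
            MvPolynomial.homogeneousSubmodule (Fin (n + 2)) ℂ s :=
          MvPolynomial.isHomogeneous_monomial _ (by rwa [Finsupp.degree_eq_sum])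
        have h2 : mono n K ∈ ⋀[ℂ]^K.card (V n) := by
          rw [exteriorPower_eq_span]
          exact Submodule.subset_span ⟨K, rfl, rfl⟩
        exact ⟨⟨_, h1⟩ ⊗ₜ ⟨_, h2⟩, by simp⟩
      · rw [SetLike.mem_coe, mem_invariants_iff]
        intro α m'
        rw [TensorProduct.mk_apply, coeffAt_tmul, MvPolynomial.coeff_monomial]
        split_ifs with h
        · rw [one_smul, torusAct_mono, hK.2 α, h]
        · simp
    exact key (hp m).1

/-! ### The Hochschild-Kostant-Rosenberg map -/

/-- The exponent of the monomial `z_{I_0} ⋯ z_{I_{s-1}}`. -/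
def exponent {n s : ℕ} (I : Fin s → Fin (n + 2)) : Fin (n + 2) →₀ ℕ :=
  ∑ k, Finsupp.single (I k) 1

theorem prod_X_eq_monomial {n s : ℕ} (I : Fin s → Fin (n + 2)) :
    ∏ k, (MvPolynomial.X (I k) : MvPolynomial (Fin (n + 2)) ℂ) =
      MvPolynomial.monomial (exponent I) 1 := by
  rw [exponent, MvPolynomial.monomial_sum_one]
  rfl

theorem exponent_apply {n s : ℕ} (I : Fin s → Fin (n + 2)) :
    ⇑(exponent I) = weight fun k => {I k} := by
  ext i
  simp [exponent, weight, Finsupp.single_apply, eq_comm]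

theorem sum_exponent {n s : ℕ} (I : Fin s → Fin (n + 2)) : ∑ i, exponent I i = s := by
  rw [exponent_apply, ← sum_card_eq_sum_weight]
  simp

theorem toMultiset_exponent {n s : ℕ} (I : Fin s → Fin (n + 2)) :
    Finsupp.toMultiset (exponent I) = (List.ofFn I : Multiset (Fin (n + 2))) := by
  rw [← Fin.univ_val_map, exponent, map_sum]
  simp only [Finsupp.toMultiset_single, one_smul]
  rw [← Multiset.sum_map_singleton (Multiset.map I Finset.univ.val), Multiset.map_map]
  rfl

theorem eq_of_antitone_of_exponent_eq {n s : ℕ} {I J : Fin s → Fin (n + 2)} (hI : Antitone I)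
    (hJ : Antitone J) (h : exponent I = exponent J) : I = J := by
  have := congrArg Finsupp.toMultiset h
  rw [toMultiset_exponent, toMultiset_exponent, Multiset.coe_eq_coe] at this
  exact List.ofFn_injective
    (this.eq_of_pairwise' hI.sortedGE_ofFn.pairwise hJ.sortedGE_ofFn.pairwise)

theorem exists_antitone_exponent_eq {n s : ℕ} {m : Fin (n + 2) →₀ ℕ} (hm : ∑ i, m i = s) :
    ∃ I : Fin s → Fin (n + 2), Antitone I ∧ exponent I = m := by
  let l := (Finsupp.toMultiset m).sort (· ≥ ·)
  have hl : (l : Multiset (Fin (n + 2))) = Finsupp.toMultiset m := Multiset.sort_eq _ _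
  have hs : l.length = s := by
    rw [← Multiset.coe_card, hl, Finsupp.card_toMultiset, ← hm]
    exact Finsupp.sum_fintype _ _ fun _ => rfl
  have hsort : l.Pairwise (· ≥ ·) := Multiset.pairwise_sort _ _
  clear_value l
  subst hs
  refine ⟨l.get, ?_, (Finsupp.orderIsoMultiset (ι := Fin (n + 2))).injective ?_⟩
  · rw [← List.sortedGE_ofFn_iff, List.ofFn_get]
    exact hsort.sortedGE
  · rw [Finsupp.coe_orderIsoMultiset, toMultiset_exponent, List.ofFn_get, hl]

theorem gen_comp_eq_letters {n s : ℕ} (I : Fin s → Fin (n + 2)) :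
    (fun k => gen n (I k)) = letters fun k => {I k} :=
  funext fun k => (mono_singleton (I k)).symm

theorem coeffAt_hkr {n s : ℕ} (f : Cochain n s) (m : Fin (n + 2) →₀ ℕ) :
    coeffAt m (hkr f) = ∑ I : Fin s → Fin (n + 2),
      if exponent I = m then f (letters fun k => {I k}) else 0 := by
  rw [hkr, map_sum]
  refine Finset.sum_congr rfl fun I _ => ?_
  rw [coeffAt_tmul, prod_X_eq_monomial, MvPolynomial.coeff_monomial, gen_comp_eq_letters, ite_smul,
    one_smul, zero_smul]

theorem hkr_add {n s : ℕ} (f g : Cochain n s) : hkr (f + g) = hkr f + hkr g := by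
  simp only [hkr, add_apply, TensorProduct.tmul_add, Finset.sum_add_distrib]

theorem hkr_smul {n s : ℕ} (c : ℂ) (f : Cochain n s) : hkr (c • f) = c • hkr f := by
  simp only [hkr, smul_apply, TensorProduct.tmul_smul, Finset.smul_sum]

/-- The Hochschild-Kostant-Rosenberg map as a linear map on cochains. -/
def hkrLinear (n s : ℕ) : Cochain n s →ₗ[ℂ] PolyVec n where
  toFun := hkr
  map_add' := hkr_add
  map_smul' := hkr_smul

theorem hkr_mem_hkrTarget {n s : ℕ} {t : ℚ} {f : Cochain n s} (hf : f ∈ cochains n s t) :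
    hkr f ∈ hkrTarget n s t := by
  rw [mem_hkrTarget_iff]
  intro m
  rw [coeffAt_hkr]
  constructor
  · refine Submodule.sum_mem _ fun I _ => ?_
    split_ifs with h
    · rw [← h, exponent_apply]
      exact mem_cochains_iff.1 hf _
    · exact zero_mem _
  · intro hm
    refine Finset.sum_eq_zero fun I _ => if_neg ?_
    rintro rfl
    exact hm (sum_exponent I)

theorem gen_mul_gen {n : ℕ} (i j : Fin (n + 2)) : gen n i * gen n j = -(gen n j * gen n i) :=
  eq_neg_of_add_eq_zero_left (ExteriorAlgebra.ι_add_mul_swap _ _)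

/-- The generators are odd in the supercommutative algebra `A`. -/
theorem mul_gen {n : ℕ} (x : A n) (i : Fin (n + 2)) : x * gen n i = gen n i * parity n x := by
  induction x using ExteriorAlgebra.induction with
  | algebraMap r => rw [AlgHom.commutes, Algebra.commutes]
  | ι v =>
    rw [parity, ExteriorAlgebra.map_apply_ι, LinearMap.neg_apply, LinearMap.id_apply, map_neg,
      mul_neg]
    exact eq_neg_of_add_eq_zero_left (ExteriorAlgebra.ι_add_mul_swap _ _)
  | mul a b ha hb => rw [mul_assoc, hb, ← mul_assoc, ha, map_mul, mul_assoc]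
  | add a b ha hb => rw [add_mul, ha, hb, map_add, mul_add]

theorem parity_gen {n : ℕ} (i : Fin (n + 2)) : parity n (gen n i) = -gen n i := by
  rw [parity, gen, ExteriorAlgebra.map_apply_ι, LinearMap.neg_apply, LinearMap.id_apply, map_neg]

/-- Exchanging two neighbouring generators changes the sign of their product, and does not change
the monomial in the `z_i`. -/
theorem hkr_innerTerm {n s : ℕ} (i : Fin s) (f : Cochain n s) : hkr (innerTerm i f) = 0 := by
  let σ : Equiv.Perm (Fin (s + 1)) := Equiv.swap i.castSucc i.succ
  have hne : i.castSucc ≠ i.succ := i.castSucc_lt_succ.ne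
  have hswap : ∀ I : Fin (s + 1) → Fin (n + 2),
      innerTerm i f (fun k => gen n (I (σ k))) = -innerTerm i f fun k => gen n (I k) := by
    intro I
    rw [innerTerm_apply, innerTerm_apply]
    set a := Fin.contractNth i.castSucc (· * ·) (fun k => gen n (I k)) with ha
    have : Fin.contractNth i.castSucc (· * ·) (fun k => gen n (I (σ k))) =
        Function.update a i (-a i) := by
      ext1 j
      rcases lt_trichotomy j i with hj | rfl | hj
      · rw [Function.update_of_ne hj.ne, ha, Fin.contractNth_apply_of_lt _ _ _ _ hj,
          Fin.contractNth_apply_of_lt _ _ _ _ hj, Equiv.swap_apply_of_ne_of_ne]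
        · exact fun h => hj.ne (Fin.castSucc_injective _ h)
        · exact (Fin.castSucc_lt_succ_iff.2 hj.le).ne
      · rw [Function.update_self, ha, Fin.contractNth_apply_of_eq _ _ _ _ rfl,
          Fin.contractNth_apply_of_eq _ _ _ _ rfl, Equiv.swap_apply_left, Equiv.swap_apply_right,
          gen_mul_gen]
      · rw [Function.update_of_ne hj.ne', ha, Fin.contractNth_apply_of_gt _ _ _ _ hj,
          Fin.contractNth_apply_of_gt _ _ _ _ hj, Equiv.swap_apply_of_ne_of_ne]
        · exact (Fin.castSucc_lt_succ_iff.2 hj.le).ne'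
        · exact fun h => hj.ne' (Fin.succ_injective _ h)
    rw [this, ← neg_one_smul ℂ (a i), MultilinearMap.map_update_smul, Function.update_eq_self,
      neg_one_smul]
  have hself : hkr (innerTerm i f) = -hkr (innerTerm i f) := by
    conv_lhs => rw [hkr, ← (Equiv.arrowCongr σ (Equiv.refl (Fin (n + 2)))).symm.sum_comp]
    rw [hkr, ← Finset.sum_neg_distrib]
    refine Finset.sum_congr rfl fun I _ => ?_
    have e : ∀ k, (Equiv.arrowCongr σ (Equiv.refl (Fin (n + 2)))).symm I k = I (σ k) :=
      fun k => rfl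
    simp only [e]
    rw [hswap, TensorProduct.tmul_neg, Equiv.prod_comp σ fun k => MvPolynomial.X (I k)]
  have h2 : (2 : ℂ) • hkr (innerTerm i f) = 0 := by
    rw [two_smul]
    nth_rewrite 2 [hself]
    exact add_neg_cancel _
  exact (smul_eq_zero.1 h2).resolve_left two_ne_zero

theorem leftTerm_gen {n s : ℕ} (f : Cochain n s) (i : Fin (n + 2)) (J : Fin s → Fin (n + 2)) :
    leftTerm f (Fin.cons (gen n i) fun k => gen n (J k)) =
      (-1 : ℂ) ^ s • (f (fun k => gen n (J k)) * gen n i) := by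
  rw [leftTerm_apply, Fin.cons_zero, Fin.tail_cons, evenPart_apply, oddPart_apply, parity_gen,
    add_neg_cancel, smul_zero, zero_mul, zero_add, sub_neg_eq_add, ← two_smul ℂ (gen n i),
    smul_smul, gen_comp_eq_letters, conjParity_letters, mul_gen]
  norm_num

/-- The Hochschild-Kostant-Rosenberg map vanishes on coboundaries. -/
theorem hkr_hochDiff {n s : ℕ} (f : Cochain n s) : hkr (hochDiff n s f) = 0 := by
  have h : hochDiff n s f = leftTerm f + ∑ i : Fin s, (-1 : ℂ) ^ (i.val + 1) • innerTerm i f +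
      (-1 : ℂ) ^ (s + 1) • rightTerm f := rfl
  have h0 : hkr (∑ i : Fin s, (-1 : ℂ) ^ (i.val + 1) • innerTerm i f) = 0 :=
    (map_sum (hkrLinear n (s + 1)) _ _).trans (Finset.sum_eq_zero fun i _ => by
      change hkr _ = 0
      rw [hkr_smul, hkr_innerTerm, smul_zero])
  rw [h, hkr_add, hkr_add, hkr_smul, h0, add_zero, hkr, hkr,
    ← (Fin.consEquiv fun _ : Fin (s + 1) => Fin (n + 2)).sum_comp,
    ← (Fin.snocEquiv fun _ : Fin (s + 1) => Fin (n + 2)).sum_comp, Finset.smul_sum,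
    ← Finset.sum_add_distrib]
  refine Finset.sum_eq_zero ?_
  rintro ⟨i, J⟩ -
  have e1 : (Fin.consEquiv fun _ : Fin (s + 1) => Fin (n + 2)) (i, J) = Fin.cons i J := rfl
  have e2 : (Fin.snocEquiv fun _ : Fin (s + 1) => Fin (n + 2)) (i, J) = Fin.snoc J i := rfl
  have e3 : (fun k => gen n ((Fin.cons i J : Fin (s + 1) → Fin (n + 2)) k)) =
      Fin.cons (gen n i) fun k => gen n (J k) := by
    ext1 k
    refine Fin.cases ?_ (fun k => ?_) k <;> simp
  have e4 : rightTerm f (fun k => gen n ((Fin.snoc J i : Fin (s + 1) → Fin (n + 2)) k)) =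
      f (fun k => gen n (J k)) * gen n i := by
    rw [rightTerm_apply]
    simp [Fin.init_def]
  rw [e1, e2, e3, e4, leftTerm_gen, Fin.prod_univ_succ, Fin.prod_univ_castSucc]
  simp only [Fin.cons_zero, Fin.cons_succ, Fin.snoc_castSucc, Fin.snoc_last]
  rw [TensorProduct.tmul_smul, mul_comm, pow_succ]
  simp

theorem antitone_of_not_isUpper {n s : ℕ} {I : Fin s → Fin (n + 2)}
    (h : ¬IsUpper fun k => ({I k} : Finset (Fin (n + 2)))) : Antitone I := by
  rcases isUpper_or_isCritical_or_exists fun k => ({I k} : Finset (Fin (n + 2))) with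
    hw | ⟨J, hJ, hw⟩ | ⟨u, k, hu, hw⟩
  · exact absurd hw h
  · have : I = J := funext fun k => Finset.singleton_injective (congrFun hw k)
    rwa [this]
  · rcases hu with hu | ⟨r, hr, hu⟩
    · have := hu.two_le_card
      rw [hw] at this
      simp at this
    · have hr2 := hu.one_lt hr
      obtain ⟨j, -, hj⟩ := (hu.isUnitRun_merge hr2).exists_eq_empty
      rw [hw] at hj
      simp at hj

/-- On cochains that vanish on upper words, the Hochschild-Kostant-Rosenberg map records precisely
the values on critical words. -/
theorem coeffAt_hkr_of_isUpper {n s : ℕ} {f : Cochain n s}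
    (hupper : ∀ w, IsUpper w → f (letters w) = 0) {I : Fin s → Fin (n + 2)} (hI : Antitone I) :
    coeffAt (exponent I) (hkr f) = f (letters fun k => {I k}) := by
  rw [coeffAt_hkr, Finset.sum_eq_single I, if_pos rfl]
  · intro J _ hJI
    split_ifs with h
    · apply hupper
      by_contra hJ
      exact hJI (eq_of_antitone_of_exponent_eq (antitone_of_not_isUpper hJ) hI h)
    · rfl
  · simp

/-- A reformulation of `eq_zero_of_forall_isUpper` with the Hochschild-Kostant-Rosenberg map in place
of the critical values. -/
theorem eq_zero_of_hkr_eq_zero {n s : ℕ} {f : Cochain n s}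
    (hupper : ∀ w, IsUpper w → f (letters w) = 0) (hkr0 : hkr f = 0)
    (hδ : ∀ u, IsUpper u → hochDiff n s f (letters u) = 0) : f = 0 := by
  refine eq_zero_of_forall_isUpper hupper ?_ hδ
  rintro _ ⟨I, hI, rfl⟩
  rw [← coeffAt_hkr_of_isUpper hupper hI, hkr0, map_zero]

/-- A cocycle which the Hochschild-Kostant-Rosenberg map annihilates is a coboundary. -/
theorem mem_coboundaries_of_hkr_eq_zero {n s : ℕ} {t : ℚ} {f : Cochain n s}
    (hf : f ∈ cocycles n s t) (h0 : hkr f = 0) : f ∈ coboundaries n s t := by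
  have hδ : hochDiff n s f = 0 := hf.2
  cases s with
  | zero =>
    rw [coboundaries, Submodule.mem_bot]
    exact eq_zero_of_hkr_eq_zero (fun w hw => hw.elim) h0 fun u _ => by rw [hδ]; rfl
  | succ s =>
    obtain ⟨g, hg, -, hgu⟩ := exists_cochain_of_isUpper (t := t) (0 : Word n s → A n)
      (fun w => zero_mem _) (fun u => f (letters u)) (mem_cochains_iff.1 hf.1)
    refine ⟨g, hg, ?_⟩
    rw [eq_comm, ← sub_eq_zero]
    refine eq_zero_of_hkr_eq_zero (fun w hw => ?_) ?_ fun u _ => ?_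
    · rw [sub_apply, hgu w hw, sub_self]
    · change hkrLinear n (s + 1) _ = 0
      rw [map_sub]
      change hkr f - hkr _ = 0
      rw [h0, hkr_hochDiff, sub_zero]
    · rw [map_sub, hδ, hochDiff_hochDiff, sub_zero]
      rfl

theorem not_isUpper_of_isCritical {n s : ℕ} {w : Word n s} (h : IsCritical w) : ¬IsUpper w := by
  obtain ⟨I, hI, rfl⟩ := h
  cases s with
  | zero => exact id
  | succ s =>
    rintro ⟨k, hk | ⟨r, hr, hk⟩⟩
    · have := hk.lt (I k.castSucc) (by simp) (I k.succ) (by simp)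
      exact this.not_ge (hI k.castSucc_lt_succ.le)
    · obtain ⟨j, -, hj⟩ := hk.exists_eq_empty
      simp at hj

/-- The Hochschild-Kostant-Rosenberg map is surjective on cocycles. -/
theorem exists_cocycle_hkr_eq {n s : ℕ} {t : ℚ} {p : PolyVec n} (hp : p ∈ hkrTarget n s t) :
    ∃ f ∈ cocycles n s t, hkr f = p := by
  classical
  rw [mem_hkrTarget_iff] at hp
  obtain ⟨f, hf, hfF, hδ⟩ := exists_cochain_of_isUpper (t := t)
    (fun w : Word n s => if IsUpper w then 0 else
      coeffAt (Finsupp.equivFunOnFinite.symm (weight w)) p)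
    (fun w => by
      split_ifs
      · exact zero_mem _
      · exact (hp (Finsupp.equivFunOnFinite.symm (weight w))).1)
    0 (fun u => zero_mem _)
  have hupper : ∀ w, IsUpper w → f (letters w) = 0 := fun w hw => by
    rw [hfF w (Or.inl hw), if_pos hw]
  refine ⟨f, ⟨hf, ?_⟩, polyVec_ext fun m => ?_⟩
  · refine eq_zero_of_hkr_eq_zero hδ (hkr_hochDiff f) fun u _ => ?_
    rw [hochDiff_hochDiff]
    rfl
  · by_cases hm : ∑ i, m i = s
    · obtain ⟨I, hI, rfl⟩ := exists_antitone_exponent_eq hm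
      have hc : IsCritical (fun k => ({I k} : Finset (Fin (n + 2)))) := ⟨I, hI, rfl⟩
      rw [coeffAt_hkr_of_isUpper hupper hI, hfF _ (Or.inr hc),
        if_neg (not_isUpper_of_isCritical hc), ← exponent_apply]
      simp
    · rw [(hp m).2 hm, (mem_hkrTarget_iff.1 (hkr_mem_hkrTarget hf) m).2 hm]

/-- The Hochschild-Kostant-Rosenberg map from cocycles to its target. -/
def hkrCocycles (n s : ℕ) (t : ℚ) : cocycles n s t →ₗ[ℂ] hkrTarget n s t :=
  ((hkrLinear n s).comp (cocycles n s t).subtype).codRestrict _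
    fun f => hkr_mem_hkrTarget f.2.1

theorem coboundaries_le_ker (n s : ℕ) (t : ℚ) :
    (coboundaries n s t).submoduleOf (cocycles n s t) ≤ LinearMap.ker (hkrCocycles n s t) := by
  intro f hf
  rw [Submodule.submoduleOf, Submodule.mem_comap] at hf
  rw [LinearMap.mem_ker]
  refine Subtype.ext ?_
  change hkr (f : Cochain n s) = 0
  cases s with
  | zero =>
    rw [coboundaries, Submodule.mem_bot, Submodule.subtype_apply] at hf
    rw [hf]
    exact map_zero (hkrLinear n 0)
  | succ s =>
    obtain ⟨g, -, hg⟩ := hf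
    rw [Submodule.subtype_apply] at hg
    rw [← hg, hkr_hochDiff]

/-- The isomorphism induced by the Hochschild-Kostant-Rosenberg map. -/
def hkrEquiv (n s : ℕ) (t : ℚ) : HH n s t ≃ₗ[ℂ] hkrTarget n s t :=
  LinearEquiv.ofBijective (Submodule.liftQ (M₂ := hkrTarget n s t)
    ((coboundaries n s t).submoduleOf (cocycles n s t)) (hkrCocycles n s t)
    (coboundaries_le_ker n s t)) <| by
    constructor
    · refine (injective_iff_map_eq_zero _).2 fun x hx => ?_
      obtain ⟨f, rfl⟩ := Submodule.Quotient.mk_surjective _ x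
      exact (Submodule.Quotient.mk_eq_zero _).2
        (mem_coboundaries_of_hkr_eq_zero f.2 (congrArg Subtype.val hx))
    · rintro ⟨p, hp⟩
      obtain ⟨f, hf, rfl⟩ := exists_cocycle_hkr_eq hp
      exact ⟨Submodule.Quotient.mk ⟨f, hf⟩, rfl⟩

/-! ### The second cohomology -/

/-- The character of `M` induced by `x ↦ 2 ^ (x_a - x_b)`. -/
def twoCharacter {n : ℕ} (a b : Fin (n + 2)) : Torus n :=
  let ψ : M n →+ ℤ := QuotientAddGroup.lift _
    (Pi.evalAddMonoidHom (fun _ : Fin (n + 2) => ℤ) a -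
      Pi.evalAddMonoidHom (fun _ : Fin (n + 2) => ℤ) b) (by
        intro x hx
        obtain ⟨k, rfl⟩ := AddSubgroup.mem_zmultiples_iff.1 hx
        simp)
  { toFun := fun x => (Units.mk0 (2 : ℂ) two_ne_zero) ^ ψ x
    map_zero_eq_one' := by simp
    map_add_eq_mul' := fun x y => by rw [map_add, zpow_add] }

theorem twoCharacter_eM {n : ℕ} (a b i : Fin (n + 2)) :
    ((twoCharacter a b (eM n i) : ℂˣ) : ℂ) =
      (2 : ℂ) ^ ((if a = i then 1 else 0) - (if b = i then 1 else 0) : ℤ) := by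
  have : twoCharacter a b (eM n i) = (Units.mk0 (2 : ℂ) two_ne_zero) ^
    ((Pi.single i (1 : ℤ) : Fin (n + 2) → ℤ) a - (Pi.single i (1 : ℤ) : Fin (n + 2) → ℤ) b) := rfl
  rw [this, Units.val_zpow_eq_zpow_val, Units.val_mk0, Pi.single_apply, Pi.single_apply]

/-- Equal torus characters have exponent vectors that differ by a multiple of `(1, …, 1)`. -/
theorem sub_eq_of_allowed {n : ℕ} {t : ℚ} {m : Fin (n + 2) → ℕ} {K : Finset (Fin (n + 2))}
    (h : Allowed t m K) (a b : Fin (n + 2)) :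
    ((if a ∈ K then 1 else 0) - m a : ℤ) = (if b ∈ K then 1 else 0) - m b := by
  have h2 := h.2 (twoCharacter a b)
  have h3 : ∀ (S : Finset (Fin (n + 2))) (f : Fin (n + 2) → ℤ),
      ∏ i ∈ S, (2 : ℂ) ^ f i = (2 : ℂ) ^ ∑ i ∈ S, f i := by
    intro S f
    induction S using Finset.induction_on with
    | empty => simp
    | insert i S hi ih =>
      rw [Finset.prod_insert hi, Finset.sum_insert hi, ih, zpow_add₀ two_ne_zero]
  simp only [twoCharacter_eM, ← zpow_natCast, ← zpow_mul, h3] at h2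
  have h4 : Function.Injective fun k : ℤ => (2 : ℂ) ^ k := by
    intro x y hxy
    have : (2 : ℝ) ^ x = 2 ^ y := by
      have := congrArg norm hxy
      simpa using this
    exact zpow_right_injective₀ (by norm_num) (by norm_num) this
  have h5 := h4 h2
  simp only [Finset.sum_sub_distrib, sub_mul, ite_mul, one_mul, zero_mul, Finset.sum_ite_eq,
    Finset.mem_univ, if_true] at h5
  linarith

/-- In degree `2 - d` with `d > 2`, the only weight that occurs is that of `z_1 ⋯ z_{n+2}`, and its
coefficient is scalar. -/
theorem eq_of_allowed {n d : ℕ} (hd : 2 < d) {m : Fin (n + 2) → ℕ} {K : Finset (Fin (n + 2))}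
    (hm : ∑ i, m i = d) (h : Allowed (2 - d) m K) : d = n + 2 ∧ (∀ i, m i = 1) ∧ K = ∅ := by
  obtain ⟨c, hc⟩ : ∃ c : ℤ, ∀ i, ((if i ∈ K then 1 else 0) - m i : ℤ) = c :=
    ⟨_, fun i => sub_eq_of_allowed h i 0⟩
  have hcard : (K.card : ℤ) = d + c * (n + 2) := by
    have h1 : ∑ i, ((if i ∈ K then 1 else 0) - m i : ℤ) = ∑ _i : Fin (n + 2), c :=
      Finset.sum_congr rfl fun i _ => hc i
    rw [Finset.sum_sub_distrib, ← Nat.cast_sum, hm] at h1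
    simp at h1
    linarith
  have hdeg : (n : ℤ) * K.card = (2 - d) * (n + 2) + n * d := by
    have h1 := h.1
    rw [hm] at h1
    have hn : (n : ℚ) + 2 ≠ 0 := by positivity
    field_simp at h1
    have h2 : (n : ℚ) * K.card = (2 - d) * (n + 2) + n * d := by linear_combination h1
    exact_mod_cast h2
  -- eliminating `K.card` from the two equations leaves a multiple of `n + 2`
  have hdc : (d : ℤ) + n * c = 2 := by
    have hn : ((n : ℤ) + 2) ≠ 0 := by positivity
    refine mul_left_cancel₀ hn ?_
    rw [hcard] at hdeg
    linear_combination hdeg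
  have hc0 : c ≤ -1 := by
    by_contra hlt
    have : 0 ≤ (n : ℤ) * c := mul_nonneg (by positivity) (by omega)
    omega
  have hcK : (K.card : ℤ) = 2 + 2 * c := by linear_combination hcard + hdc
  obtain rfl : c = -1 := by omega
  have hK : K = ∅ := Finset.card_eq_zero.1 (by omega)
  refine ⟨by omega, fun i => ?_, hK⟩
  have := hc i
  rw [hK] at this
  simp at this
  omega

theorem coeffAt_superW {n : ℕ} (m : Fin (n + 2) →₀ ℕ) :
    coeffAt m (superW n) = if ∀ i, m i = 1 then 1 else 0 := by
  have hexp : exponent (id : Fin (n + 2) → Fin (n + 2)) = m ↔ ∀ i, m i = 1 := by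
    rw [Finsupp.ext_iff]
    refine forall_congr' fun i => ?_
    simp [exponent, Finsupp.single_apply, eq_comm]
  have := prod_X_eq_monomial (id : Fin (n + 2) → Fin (n + 2))
  simp only [id] at this
  rw [superW, this, coeffAt_tmul, MvPolynomial.coeff_monomial, ite_smul, one_smul, zero_smul]
  exact if_congr hexp rfl rfl

theorem torus_prod_eq_one {n : ℕ} (α : Torus n) : ∏ i, ((α (eM n i) : ℂˣ) : ℂ) = 1 := by
  have h0 : ∑ i, eM n i = 0 := by
    have h1 : ∑ i, eM n i = QuotientAddGroup.mk'
        (AddSubgroup.zmultiples (fun _ : Fin (n + 2) => (1 : ℤ))) (∑ i, Pi.single i (1 : ℤ)) :=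
      (map_sum (QuotientAddGroup.mk'
        (AddSubgroup.zmultiples (fun _ : Fin (n + 2) => (1 : ℤ)))) _ _).symm
    rw [h1, Finset.univ_sum_single (fun _ : Fin (n + 2) => (1 : ℤ))]
    exact (QuotientAddGroup.eq_zero_iff _).2 (AddSubgroup.mem_zmultiples _)
  have h2 : ∀ S : Finset (Fin (n + 2)), α (∑ i ∈ S, eM n i) = ∏ i ∈ S, α (eM n i) := by
    intro S
    induction S using Finset.induction_on with
    | empty => simp
    | insert i S hi ih =>
      rw [Finset.sum_insert hi, Finset.prod_insert hi, AddChar.map_add_eq_mul, ih]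
  rw [← Units.coe_prod, ← h2, h0, AddChar.map_zero_eq_one, Units.val_one]

theorem superW_mem_hkrTarget {n d : ℕ} (hd : d = n + 2) : superW n ∈ hkrTarget n d (2 - d) := by
  rw [mem_hkrTarget_iff]
  intro m
  rw [coeffAt_superW]
  split_ifs with hm
  · have hsum : ∑ i, m i = n + 2 := by simp [hm]
    refine ⟨?_, fun h => absurd (hsum.trans hd.symm) h⟩
    rw [← mono_empty]
    refine Submodule.subset_span ⟨∅, ⟨?_, fun α => ?_⟩, rfl⟩
    · rw [hsum, hd]
      have hn : (n : ℚ) + 2 ≠ 0 := by positivity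
      push_cast
      field_simp
      simp
    · simp [hm, torus_prod_eq_one]
  · exact ⟨zero_mem _, fun _ => rfl⟩

theorem coeffAt_of_mem_hkrTarget {n d : ℕ} (hd : 2 < d) {p : PolyVec n}
    (hp : p ∈ hkrTarget n d (2 - d)) (m : Fin (n + 2) →₀ ℕ) :
    (∃ c : ℂ, coeffAt m p = c • 1) ∧ (¬(d = n + 2 ∧ ∀ i, m i = 1) → coeffAt m p = 0) := by
  obtain ⟨h1, h2⟩ := mem_hkrTarget_iff.1 hp m
  by_cases hm : ∑ i, m i = d
  · constructor
    · have : {K | Allowed (2 - d : ℚ) m K} ⊆ {∅} := fun K hK => (eq_of_allowed hd hm hK).2.2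
      have h3 := Submodule.span_mono (R := ℂ) (Set.image_mono (f := mono n) this) h1
      rw [Set.image_singleton, Submodule.mem_span_singleton, mono_empty] at h3
      obtain ⟨c, hc⟩ := h3
      exact ⟨c, hc.symm⟩
    · intro hne
      have : {K | Allowed (2 - d : ℚ) m K} ⊆ ∅ := fun K hK =>
        hne ⟨(eq_of_allowed hd hm hK).1, (eq_of_allowed hd hm hK).2.1⟩
      have h3 := Submodule.span_mono (R := ℂ) (Set.image_mono (f := mono n) this) h1
      rwa [Set.image_empty, Submodule.span_empty, Submodule.mem_bot] at h3
  · exact ⟨⟨0, by rw [h2 hm, zero_smul]⟩, fun _ => h2 hm⟩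

theorem hkrTarget_eq_span_superW {n d : ℕ} (hd : 2 < d) (hdn : d = n + 2) :
    hkrTarget n d (2 - d) = Submodule.span ℂ {superW n} := by
  apply le_antisymm
  · intro p hp
    obtain ⟨c, hc⟩ := (coeffAt_of_mem_hkrTarget hd hp (exponent id)).1
    rw [Submodule.mem_span_singleton]
    refine ⟨c, polyVec_ext fun m => ?_⟩
    rw [map_smul, coeffAt_superW]
    split_ifs with hm
    · rw [← hc]
      congr 2
      ext i
      rw [hm i]
      simp [exponent, Finsupp.single_apply]
    · rw [smul_zero, (coeffAt_of_mem_hkrTarget hd hp m).2 fun h => hm h.2]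
  · rw [Submodule.span_singleton_le_iff_mem]
    exact superW_mem_hkrTarget hdn

theorem hkrTarget_eq_bot {n d : ℕ} (hd : 2 < d) (hdn : d ≠ n + 2) :
    hkrTarget n d (2 - d) = ⊥ := by
  rw [eq_bot_iff]
  intro p hp
  rw [Submodule.mem_bot]
  refine polyVec_ext fun m => ?_
  rw [map_zero, (coeffAt_of_mem_hkrTarget hd hp m).2 fun h => hdn h.1]

end EquivHH

end

open EquivHH in
theorem mainTheorem8 (n : ℕ) :
    ∃ Ψ : ∀ (s : ℕ) (t : ℚ), HH n s t ≃ₗ[ℂ] hkrTarget n s t,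
      (∀ (s : ℕ) (t : ℚ) (f : cocycles n s t),
        (Ψ s t (Submodule.Quotient.mk f) : PolyVec n) = hkr (f : Cochain n s)) ∧
      ∀ d : ℕ, 2 < d →
        (d = n + 2 →
          LinearMap.range ((hkrTarget n d (2 - d)).subtype ∘ₗ (Ψ d (2 - d)).toLinearMap) =
            Submodule.span ℂ {superW n}) ∧
        (d ≠ n + 2 → Subsingleton (HH n d (2 - d))) := by
  refine ⟨hkrEquiv n, fun s t f => rfl, fun d hd => ⟨fun hdn => ?_, fun hdn => ?_⟩⟩
  · rw [LinearMap.range_comp, LinearEquiv.range, Submodule.map_top, Submodule.range_subtype,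
      hkrTarget_eq_span_superW hd hdn]
  · have : Subsingleton (hkrTarget n d (2 - d)) :=
      (Submodule.subsingleton_iff_eq_bot).2 (hkrTarget_eq_bot hd hdn)
    exact (hkrEquiv n d (2 - d)).toEquiv.subsingleton
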